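/- **Proposition 2.2.** Let $n\ge 1$ and let $(W_n,S_n)$ be the Coxeter system of type $B_n$, with $S_n=\{t,s_1,\dots,s_{n-1}\}$, where $ts_1$ has order $4$ (if $n\ge2$), $s_is_{i+1}$ has order $3$, and all other pairs of distinct generators commute. Let $\ell$ be the length function, let $\ell_t(w)$ be the number of occurrences of $t$ in a reduced expression of $w$ (it does not depend on the reduced expression), and put $\ell_s=\ell-\ell_t$. Let $\Gamma=\mathbb Z^2$, ordered lexicographically, let $A=\mathbb Z[\Gamma]=\bigoplus_{\gamma\in\Gamma}\mathbb Z v^\gamma$, $V=v^{(1,0)}$, $v=v^{(0,1)}$ (so $A=\mathbb Z[V^{\pm1},v^{\pm1}]$), and let $A_{<0}=\bigoplus_{\gamma<0}\mathbb Z v^\gamma$. Put $L(w)=(\ell_t(w),\ell_s(w))\in\Gamma$. Let $\mathcal H_n$ be the Hecke algebra of $(W_n,S_n,L)$: the associative $A$-algebra with $A$-basis $(T_w)_{w\in W_n}$ and multiplication determined by $T_wT_{w'}=T_{ww'}$ if $\ell(ww')=\ell(w)+\ell(w')$, and $T_s^2=1+(v^{L(s)}-v^{-L(s)})T_s$ for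 $s\in S_n$. Let $\mathcal H(\mathfrak S_n)$ be the $A$-subalgebra of $\mathcal H_n$ generated by $T_{s_1},\dots,T_{s_{n-1}}$. Let $a\mapsto\bar a$ be the ring automorphism of $A$ with $\overline{v^\gamma}=v^{-\gamma}$, and put $\overline{\sum_w a_wT_w}=\sum_w\overline{a_w}\,T_{w^{-1}}^{-1}$. For $w\in W_n$ let $C_w$ be the Kazhdan–Lusztig element, that is, the unique element of $\mathcal H_n$ with $\overline{C_w}=C_w$ and $C_w\in T_w+\bigoplus_{y\in W_n}A_{<0}T_y$. Let $\mathcal C_n$ be the $A$-submodule of $\mathcal H_n$ spanned by the $C_w$ with $\ell_t(w)=n$. For $h\in\mathcal H_n$ the following are equivalent: 1. $h\in\mathcal C_n$; 2. $(T_t-V)\,x\,h=0$ for all $x\in\mathcal H_n$; 3. $(T_t-V)\,x\,h=0$ for all $x\in\mathcal H(\mathfrak S_n)$. -/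

import Mathlib

namespace CoxeterHecke

section Exchange

variable {B W : Type*} [Group W] {M : CoxeterMatrix B} (cs : CoxeterSystem M W)

open Classical in
/-- The involution of `W × ℤ/2` attached to a simple reflection `s`:
`(r, e) ↦ (s r s, e + [r = s])`. -/
noncomputable def reflFlip (i : B) : Equiv.Perm (W × ZMod 2) where
  toFun p := (cs.simple i * p.1 * cs.simple i, p.2 + if p.1 = cs.simple i then 1 else 0)
  invFun p := (cs.simple i * p.1 * cs.simple i, p.2 + if p.1 = cs.simple i then 1 else 0)
  left_inv := by
    rintro ⟨r, e⟩
    have h : cs.simple i * r * cs.simple i = cs.simple i ↔ r = cs.simple i := by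
      constructor
      · intro h
        have h1 := congrArg (fun x => cs.simple i * x) h
        simp only [mul_assoc, cs.simple_mul_simple_cancel_left, cs.simple_mul_simple_self] at h1
        calc r = r * cs.simple i * cs.simple i := by simp
          _ = cs.simple i := by rw [h1]; simp
      · rintro rfl; simp
    ext
    · simp [mul_assoc]
    · simp only [h, add_assoc, CharTwo.add_self_eq_zero, add_zero]
  right_inv := by
    rintro ⟨r, e⟩
    have h : cs.simple i * r * cs.simple i = cs.simple i ↔ r = cs.simple i := by
      constructor
      · intro h
        have h1 := congrArg (fun x => cs.simple i * x) h
        simp only [mul_assoc, cs.simple_mul_simple_cancel_left, cs.simple_mul_simple_self] at h1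
        calc r = r * cs.simple i * cs.simple i := by simp
          _ = cs.simple i := by rw [h1]; simp
      · rintro rfl; simp
    ext
    · simp [mul_assoc]
    · simp only [h, add_assoc, CharTwo.add_self_eq_zero, add_zero]

open Classical in
theorem reflFlip_apply (i : B) (r : W) (e : ZMod 2) :
    reflFlip cs i (r, e) =
      (cs.simple i * r * cs.simple i, e + if r = cs.simple i then 1 else 0) := rfl

theorem simple_mul_pow (i j : B) (k : ℕ) :
    ((cs.simple i * cs.simple j) ^ k)⁻¹ * cs.simple j =
      cs.simple j * (cs.simple i * cs.simple j) ^ k := by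
  have h : SemiconjBy (cs.simple j) (cs.simple i * cs.simple j)
      (cs.simple i * cs.simple j)⁻¹ := by
    simp [SemiconjBy, mul_assoc]
  have := (h.pow_right k).eq
  rw [this, inv_pow]

open Classical in
theorem reflFlip_mul_pow (i j : B) (m : ℕ) (r : W) (e : ZMod 2) :
    ((reflFlip cs i * reflFlip cs j) ^ m) (r, e) =
      ((cs.simple i * cs.simple j) ^ m * r * ((cs.simple i * cs.simple j) ^ m)⁻¹,
        e + ∑ k ∈ Finset.range (2 * m),
          if r = ((cs.simple i * cs.simple j) ^ k)⁻¹ * cs.simple j then 1 else 0) := by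
  induction m with
  | zero => simp
  | succ m ih =>
    rw [pow_succ', Equiv.Perm.mul_apply, ih, Equiv.Perm.mul_apply, reflFlip_apply, reflFlip_apply]
    set u := cs.simple i * cs.simple j with hu
    have hj : cs.simple j * u = u⁻¹ * cs.simple j := by
      have := simple_mul_pow cs i j 1
      simp only [pow_one] at this
      exact this.symm
    have key1 : (u ^ m * r * (u ^ m)⁻¹ = cs.simple j) ↔
        r = (u ^ (2 * m))⁻¹ * cs.simple j := by
      rw [mul_inv_eq_iff_eq_mul, ← simple_mul_pow cs i j m, ← hu, ← eq_inv_mul_iff_mul_eq,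
        ← mul_assoc, two_mul, pow_add, mul_inv_rev]
    have key2 : (cs.simple j * (u ^ m * r * (u ^ m)⁻¹) * cs.simple j = cs.simple i) ↔
        r = (u ^ (2 * m + 1))⁻¹ * cs.simple j := by
      have h1 : (cs.simple j * (u ^ m * r * (u ^ m)⁻¹) * cs.simple j = cs.simple i) ↔
          u ^ m * r * (u ^ m)⁻¹ = u⁻¹ * cs.simple j := by
        constructor
        · intro h
          have h2 := congrArg (fun x => cs.simple j * x * cs.simple j) h
          simp only [mul_assoc, cs.simple_mul_simple_self, cs.simple_mul_simple_cancel_left,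
            mul_one] at h2
          rw [hu, mul_inv_rev, cs.inv_simple, cs.inv_simple, mul_assoc, mul_assoc, h2]
        · intro h
          rw [h, hu]
          simp [mul_assoc]
      rw [h1, mul_inv_eq_iff_eq_mul, mul_assoc, ← simple_mul_pow cs i j m, ← hu,
        ← eq_inv_mul_iff_mul_eq, ← mul_assoc, ← mul_assoc,
        show u ^ (2 * m + 1) = u ^ m * (u * u ^ m) by
          rw [← pow_succ', ← pow_add]; congr 1; ring]
      simp only [mul_inv_rev, mul_assoc]
    ext
    · simp only [pow_succ', mul_inv_rev, mul_assoc, hu, cs.inv_simple]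
    · rw [show 2 * (m + 1) = 2 * m + 1 + 1 by ring, Finset.sum_range_succ, Finset.sum_range_succ]
      simp only [key1, key2, add_assoc]

theorem reflFlip_liftable : M.IsLiftable (reflFlip cs) := by
  classical
  intro i j
  ext1 ⟨r, e⟩
  rw [reflFlip_mul_pow, cs.simple_mul_simple_pow, two_mul, Finset.sum_range_add]
  simp only [pow_add, cs.simple_mul_simple_pow, one_mul]
  simp [CharTwo.add_self_eq_zero]

open Classical in
theorem lift_reflFlip_wordProd (ω : List B) (r : W) (e : ZMod 2) :
    cs.lift ⟨reflFlip cs, reflFlip_liftable cs⟩ (cs.wordProd ω) (r, e) =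
      (cs.wordProd ω * r * (cs.wordProd ω)⁻¹, e + ((cs.rightInvSeq ω).count r : ℕ)) := by
  induction ω with
  | nil => simp
  | cons i ω ih =>
    rw [cs.wordProd_cons, map_mul, Equiv.Perm.mul_apply, ih, cs.lift_apply_simple, reflFlip_apply]
    have h : (cs.wordProd ω * r * (cs.wordProd ω)⁻¹ = cs.simple i) ↔
        (cs.wordProd ω)⁻¹ * cs.simple i * cs.wordProd ω = r := by
      rw [mul_inv_eq_iff_eq_mul, mul_assoc, inv_mul_eq_iff_eq_mul]
      exact eq_comm
    ext
    · simp [mul_assoc]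
    · simp only [CoxeterSystem.rightInvSeq, List.count_cons, h, add_assoc, beq_iff_eq]
      split_ifs <;> simp

/-- Reduced words of the same element have the same right inversions. -/
theorem rightInvSeq_perm {ω ω' : List B} (h : cs.IsReduced ω) (h' : cs.IsReduced ω')
    (hw : cs.wordProd ω = cs.wordProd ω') :
    (cs.rightInvSeq ω).Perm (cs.rightInvSeq ω') := by
  classical
  rw [List.perm_iff_count]
  intro r
  have e1 := lift_reflFlip_wordProd cs ω r 0
  have e2 := lift_reflFlip_wordProd cs ω' r 0
  rw [hw, e2] at e1
  have e3 := (Prod.ext_iff.mp e1).2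
  simp only [zero_add] at e3
  have b1 := List.nodup_iff_count_le_one.mp (h.nodup_rightInvSeq cs) r
  have b2 := List.nodup_iff_count_le_one.mp (h'.nodup_rightInvSeq cs) r
  have e4 := (ZMod.natCast_eq_natCast_iff' _ _ _).mp e3
  omega

/-- If `s w > w`, `w s' > w` and `s w s' < s w`, then `s w = w s'`. -/
theorem exchange {w : W} {i j : B} (h1 : cs.length w < cs.length (cs.simple i * w))
    (h2 : cs.length w < cs.length (w * cs.simple j))
    (h3 : cs.length (cs.simple i * w * cs.simple j) < cs.length (cs.simple i * w)) :
    cs.simple i * w = w * cs.simple j := by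
  obtain ⟨ω, hω, rfl⟩ := cs.exists_isReduced w
  obtain ⟨ω', hω', hx⟩ := cs.exists_isReduced (cs.simple i * cs.wordProd ω * cs.simple j)
  have e1 : cs.length (cs.simple i * cs.wordProd ω) = cs.length (cs.wordProd ω) + 1 := by
    rcases cs.length_simple_mul (cs.wordProd ω) i with h | h <;> omega
  have r1 : cs.IsReduced (i :: ω) := by
    rw [CoxeterSystem.IsReduced, cs.wordProd_cons, e1, hω.eq, List.length_cons]
  have e2 : cs.length (cs.simple i * cs.wordProd ω * cs.simple j) + 1
      = cs.length (cs.simple i * cs.wordProd ω) := by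
    rcases cs.length_mul_simple (cs.simple i * cs.wordProd ω) j with h | h <;> omega
  have p2 : cs.wordProd (ω'.concat j) = cs.simple i * cs.wordProd ω := by
    rw [cs.wordProd_concat, ← hx]; simp
  have r2 : cs.IsReduced (ω'.concat j) := by
    rw [CoxeterSystem.IsReduced, p2, ← e2, hx, hω'.eq]; simp
  have hp := rightInvSeq_perm cs r2 r1 (by rw [p2, cs.wordProd_cons])
  have hmem : cs.simple j ∈ cs.rightInvSeq (i :: ω) := by
    apply hp.subset
    rw [cs.rightInvSeq_concat]; simp
  rw [CoxeterSystem.rightInvSeq, List.mem_cons] at hmem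
  rcases hmem with h | h
  · rw [h]; simp [mul_assoc]
  · have := (cs.isRightInversion_of_mem_rightInvSeq hω h).2
    omega

end Exchange

/-- A positive weight function on a Coxeter group, with values in a totally ordered abelian
group `Γ`: `L(ww') = L(w) + L(w')` whenever `ℓ(ww') = ℓ(w) + ℓ(w')`, and `L(s) > 0`. -/
structure WeightFunction {B W : Type*} [Group W] {M : CoxeterMatrix B}
    (cs : CoxeterSystem M W) (Γ : Type*) [AddCommGroup Γ] [LinearOrder Γ] where
  toFun : W → Γ
  map_mul' : ∀ w w' : W, cs.length (w * w') = cs.length w + cs.length w' →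
    toFun (w * w') = toFun w + toFun w'
  pos' : ∀ i : B, 0 < toFun (cs.simple i)

section Ground

variable (Γ : Type*)

/-- The group algebra of `Γ` over `ℤ`. -/
abbrev Ground [AddCommGroup Γ] := AddMonoidAlgebra ℤ Γ

variable {Γ} [AddCommGroup Γ]

/-- The basis element `v^γ` of the group algebra. -/
noncomputable def vpow (γ : Γ) : Ground Γ := AddMonoidAlgebra.single γ 1

/-- The ring automorphism of the group algebra with `v^γ ↦ v^(-γ)`. -/
noncomputable def groundBar : Ground Γ →+* Ground Γ :=
  AddMonoidAlgebra.mapDomainRingHom ℤ (negAddMonoidHom : Γ →+ Γ)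

/-- `a` lies in `A_{<0}`: only exponents `γ < 0` occur in `a`. -/
def IsNegative [LinearOrder Γ] (a : Ground Γ) : Prop :=
  ∀ γ : Γ, a.coeff γ ≠ 0 → γ < 0

end Ground

section Hecke

variable {B W Γ : Type*} [Group W] {M : CoxeterMatrix B} (cs : CoxeterSystem M W)
  [AddCommGroup Γ] [LinearOrder Γ]

theorem WeightFunction.simple_eq {cs : CoxeterSystem M W} (L : WeightFunction cs Γ)
    {w : W} {i j : B} (h : cs.simple i * w = w * cs.simple j) :
    L.toFun (cs.simple i) = L.toFun (cs.simple j) := by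
  have main : ∀ w : W, cs.simple i * w = w * cs.simple j →
      cs.length (cs.simple i * w) = cs.length w + 1 →
      L.toFun (cs.simple i) = L.toFun (cs.simple j) := by
    intro w h hl
    have a1 := L.map_mul' (cs.simple i) w (by rw [hl, cs.length_simple]; omega)
    have a2 := L.map_mul' w (cs.simple j) (by rw [← h, hl, cs.length_simple])
    rw [h, a2, add_comm] at a1
    exact (add_right_cancel a1).symm
  rcases cs.length_simple_mul w i with hl | hl
  · exact main w h hl
  · refine main (cs.simple i * w) ?_ ?_
    · rw [mul_assoc, ← h]
    · simpa using hl.symm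

/-- The Hecke algebra of `(W, S, L)`: as a module over the group algebra `A` of `Γ`,
it is free with basis indexed by `W`. The multiplication is constructed below from the
left regular representation; `T_mul_T` and `T_simple_sq` are its two defining relations. -/
def Hecke (_L : WeightFunction cs Γ) : Type _ := W →₀ Ground Γ

variable {cs} (L : WeightFunction cs Γ)

namespace Hecke

noncomputable instance instAddCommGroup : AddCommGroup (Hecke cs L) :=
  inferInstanceAs (AddCommGroup (W →₀ Ground Γ))

noncomputable instance instModule : Module (Ground Γ) (Hecke cs L) :=
  inferInstanceAs (Module (Ground Γ) (W →₀ Ground Γ))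

/-- The standard basis `(T_w)` of the Hecke algebra. -/
noncomputable def basis : Module.Basis W (Ground Γ) (Hecke cs L) :=
  Module.Basis.ofRepr (LinearEquiv.refl (Ground Γ) (W →₀ Ground Γ))

/-- The basis element `T_w`. -/
noncomputable def T (w : W) : Hecke cs L := basis L w

/-- The parameter `v^{L(s)} - v^{-L(s)}`. -/
noncomputable def xi (i : B) : Ground Γ :=
  vpow (L.toFun (cs.simple i)) - vpow (-L.toFun (cs.simple i))

theorem xi_eq {w : W} {i j : B} (h : cs.simple i * w = w * cs.simple j) :
    xi L i = xi L j := by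
  rw [xi, xi, L.simple_eq h]

/-- Left multiplication by `T_s`. -/
noncomputable def lmul (i : B) : Module.End (Ground Γ) (Hecke cs L) :=
  (basis L).constr ℤ fun w =>
    if cs.length w < cs.length (cs.simple i * w) then T L (cs.simple i * w)
    else T L (cs.simple i * w) + xi L i • T L w

/-- Right multiplication by `T_s`. -/
noncomputable def rmul (i : B) : Module.End (Ground Γ) (Hecke cs L) :=
  (basis L).constr ℤ fun w =>
    if cs.length w < cs.length (w * cs.simple i) then T L (w * cs.simple i)
    else T L (w * cs.simple i) + xi L i • T L w

theorem lmul_up {i : B} {w : W} (h : cs.length w < cs.length (cs.simple i * w)) :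
    lmul L i (T L w) = T L (cs.simple i * w) := by
  rw [lmul, T, Module.Basis.constr_basis, if_pos h]

theorem lmul_down {i : B} {w : W} (h : cs.length (cs.simple i * w) < cs.length w) :
    lmul L i (T L w) = T L (cs.simple i * w) + xi L i • T L w := by
  rw [lmul, T, Module.Basis.constr_basis, if_neg (by omega)]; rfl

theorem rmul_up {i : B} {w : W} (h : cs.length w < cs.length (w * cs.simple i)) :
    rmul L i (T L w) = T L (w * cs.simple i) := by
  rw [rmul, T, Module.Basis.constr_basis, if_pos h]

theorem rmul_down {i : B} {w : W} (h : cs.length (w * cs.simple i) < cs.length w) :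
    rmul L i (T L w) = T L (w * cs.simple i) + xi L i • T L w := by
  rw [rmul, T, Module.Basis.constr_basis, if_neg (by omega)]; rfl

theorem lmul_rmul (i j : B) : Commute (lmul L i) (rmul L j) := by
  apply (basis L).ext
  intro w
  change lmul L i (rmul L j (T L w)) = rmul L j (lmul L i (T L w))
  have A1 := cs.length_simple_mul w i
  have A2 := cs.length_mul_simple w j
  have A3 := cs.length_simple_mul (w * cs.simple j) i
  have A4 := cs.length_mul_simple (cs.simple i * w) j
  rw [← mul_assoc] at A3
  have ss : cs.simple i * (cs.simple i * w) = w := by simp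
  have tt : w * cs.simple j * cs.simple j = w := by simp
  have tt2 : cs.simple i * w * cs.simple j * cs.simple j = cs.simple i * w := by simp
  rcases A1 with A1 | A1 <;> rcases A2 with A2 | A2
  · rw [rmul_up L (w := w) (i := j) (by omega), lmul_up L (w := w) (i := i) (by omega)]
    rcases A3 with A3 | A3
    · rw [lmul_up L (w := w * cs.simple j) (i := i) (by rw [← mul_assoc]; omega),
        rmul_up L (w := cs.simple i * w) (i := j) (by omega), mul_assoc]
    · have e := exchange cs (w := w) (i := i) (j := j) (by omega) (by omega) (by omega)
      rw [← e, lmul_down L (w := cs.simple i * w) (i := i) (by rw [ss]; omega), ss, e,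
        rmul_down L (w := w * cs.simple j) (i := j) (by rw [tt]; omega), tt, xi_eq L e]
  · rw [rmul_down L (w := w) (i := j) (by omega), lmul_up L (w := w) (i := i) (by omega),
      map_add, map_smul, lmul_up L (w := w) (i := i) (by omega),
      lmul_up L (w := w * cs.simple j) (i := i) (by rw [← mul_assoc]; omega),
      rmul_down L (w := cs.simple i * w) (i := j) (by omega), mul_assoc]
  · rw [rmul_up L (w := w) (i := j) (by omega), lmul_down L (w := w) (i := i) (by omega),
      map_add, map_smul, rmul_up L (w := w) (i := j) (by omega),
      rmul_up L (w := cs.simple i * w) (i := j) (by omega),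
      lmul_down L (w := w * cs.simple j) (i := i) (by rw [← mul_assoc]; omega), mul_assoc]
  · rw [rmul_down L (w := w) (i := j) (by omega), lmul_down L (w := w) (i := i) (by omega),
      map_add, map_add, map_smul, map_smul, lmul_down L (w := w) (i := i) (by omega),
      rmul_down L (w := w) (i := j) (by omega)]
    rcases A3 with A3 | A3
    · have e := exchange cs (w := cs.simple i * w) (i := i) (j := j)
        (by rw [ss]; omega) (by omega) (by rw [ss]; omega)
      rw [ss] at e
      have e2 : w * cs.simple j = cs.simple i * w := by
        calc w * cs.simple j = cs.simple i * w * cs.simple j * cs.simple j := by rw [← e]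
          _ = _ := tt2
      rw [xi_eq L e2.symm, e2, lmul_up L (w := cs.simple i * w) (i := i) (by rw [ss]; omega),
        rmul_up L (w := cs.simple i * w) (i := j) (by omega), ss, ← e]
    · rw [lmul_down L (w := w * cs.simple j) (i := i) (by rw [← mul_assoc]; omega),
        rmul_down L (w := cs.simple i * w) (i := j) (by omega), mul_assoc]
      simp only [smul_add, smul_smul, mul_comm (xi L i) (xi L j)]
      abel

/-- A reduced word of `w`. -/
noncomputable def redWord (cs : CoxeterSystem M W) (w : W) : List B :=
  Classical.choose (cs.exists_isReduced w)

theorem redWord_isReduced (cs : CoxeterSystem M W) (w : W) : cs.IsReduced (redWord cs w) :=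
  (Classical.choose_spec (cs.exists_isReduced w)).1

theorem redWord_prod (cs : CoxeterSystem M W) (w : W) : cs.wordProd (redWord cs w) = w :=
  (Classical.choose_spec (cs.exists_isReduced w)).2.symm

/-- The algebra of operators generated by the left multiplications. -/
noncomputable def ops : Subalgebra (Ground Γ) (Module.End (Ground Γ) (Hecke cs L)) :=
  Algebra.adjoin (Ground Γ) (Set.range (lmul L))

theorem word_apply (ω : List B) (w : W)
    (h : cs.length (cs.wordProd ω * w) = ω.length + cs.length w) :
    (ω.map (lmul L)).prod (T L w) = T L (cs.wordProd ω * w) := by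
  induction ω with
  | nil => simp
  | cons i ω ih =>
    rw [cs.wordProd_cons, mul_assoc, List.length_cons] at h
    have h1 := cs.length_mul_le (cs.wordProd ω) w
    have h2 := cs.length_wordProd_le ω
    have h3 := cs.length_simple_mul (cs.wordProd ω * w) i
    rw [List.map_cons, List.prod_cons, Module.End.mul_apply, ih (by omega),
      lmul_up L (by omega), cs.wordProd_cons, mul_assoc]

theorem word_apply_one (ω : List B) (h : cs.IsReduced ω) :
    (ω.map (lmul L)).prod (T L 1) = T L (cs.wordProd ω) := by
  simpa using word_apply L ω 1 (by simpa using h.eq)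

theorem word_apply_one_right (ω : List B) (h : cs.IsReduced ω) :
    (ω.reverse.map (rmul L)).prod (T L 1) = T L (cs.wordProd ω) := by
  induction ω using List.reverseRecOn with
  | nil => simp
  | append_singleton ω i ih =>
    have h1 : cs.length (cs.wordProd ω * cs.simple i) = ω.length + 1 := by
      simpa [CoxeterSystem.IsReduced, cs.wordProd_append] using h
    have h2 := cs.length_wordProd_le ω
    have h3 := cs.length_mul_simple (cs.wordProd ω) i
    have hr : cs.IsReduced ω := by
      rw [CoxeterSystem.IsReduced]; omega
    rw [List.reverse_append, List.map_append, List.prod_append, Module.End.mul_apply, ih hr]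
    simp only [List.reverse_singleton, List.map_singleton, List.prod_singleton]
    rw [rmul_up L (by omega)]
    simp [cs.wordProd_append]

theorem ops_commute {f : Module.End (Ground Γ) (Hecke cs L)} (hf : f ∈ ops L) (j : B) :
    Commute f (rmul L j) := by
  induction hf using Algebra.adjoin_induction with
  | mem x hx => obtain ⟨i, rfl⟩ := hx; exact lmul_rmul L i j
  | algebraMap r => exact Algebra.commute_algebraMap_left r _
  | add x y _ _ hx hy => exact hx.add_left hy
  | mul x y _ _ hx hy => exact hx.mul_left hy

/-- An operator of the algebra is determined by its value at `T_1`. -/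
theorem ops_ext {f g : Module.End (Ground Γ) (Hecke cs L)} (hf : f ∈ ops L) (hg : g ∈ ops L)
    (h : f (T L 1) = g (T L 1)) : f = g := by
  apply (basis L).ext
  intro w
  change f (T L w) = g (T L w)
  have hc : ∀ k ∈ ops L, k (T L w) =
      (((redWord cs w).reverse.map (rmul L)).prod) (k (T L 1)) := by
    intro k hk
    have hcomm : Commute k (((redWord cs w).reverse.map (rmul L)).prod) := by
      apply Commute.list_prod_right
      intro x hx
      obtain ⟨j, _, rfl⟩ := List.mem_map.mp hx
      exact ops_commute L hk j
    have := word_apply_one_right L (redWord cs w) (redWord_isReduced cs w)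
    rw [redWord_prod] at this
    rw [← this, ← Module.End.mul_apply, hcomm.eq, Module.End.mul_apply]
  rw [hc f hf, hc g hg, h]

/-- Left multiplication by an element of the Hecke algebra: the `A`-linear extension of
`T_w ↦ T_{s_1} ⋯ T_{s_k}` with `w = s_1 ⋯ s_k` reduced. -/
noncomputable def leftMul : Hecke cs L →ₗ[Ground Γ] Module.End (Ground Γ) (Hecke cs L) :=
  (basis L).constr ℤ fun w => ((redWord cs w).map (lmul L)).prod

theorem leftMul_T (w : W) : leftMul L (T L w) = ((redWord cs w).map (lmul L)).prod := by
  rw [leftMul, T, Module.Basis.constr_basis]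

theorem leftMul_mem (h : Hecke cs L) : leftMul L h ∈ ops L := by
  have hs : h ∈ Submodule.span (Ground Γ) (Set.range (basis L)) := by
    rw [(basis L).span_eq]; trivial
  induction hs using Submodule.span_induction with
  | mem x hx =>
    obtain ⟨w, rfl⟩ := hx
    change leftMul L (T L w) ∈ _
    rw [leftMul_T]
    apply list_prod_mem
    intro x hx
    obtain ⟨j, _, rfl⟩ := List.mem_map.mp hx
    exact Algebra.subset_adjoin ⟨j, rfl⟩
  | zero => rw [map_zero]; exact zero_mem _
  | add x y _ _ hx hy => rw [map_add]; exact add_mem hx hy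
  | smul a x _ hx => rw [map_smul]; exact Subalgebra.smul_mem _ hx a

theorem leftMul_apply_one (h : Hecke cs L) : leftMul L h (T L 1) = h := by
  have : (LinearMap.applyₗ (T L 1)).comp (leftMul L) = LinearMap.id := by
    apply (basis L).ext
    intro w
    change leftMul L (T L w) (T L 1) = T L w
    rw [leftMul_T, word_apply_one L _ (redWord_isReduced cs w), redWord_prod]
  exact LinearMap.congr_fun this h

theorem leftMul_one : leftMul L (T L 1) = 1 :=
  ops_ext L (leftMul_mem L _) (one_mem _) (leftMul_apply_one L _)

theorem leftMul_leftMul (x y : Hecke cs L) :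
    leftMul L (leftMul L x y) = leftMul L x * leftMul L y :=
  ops_ext L (leftMul_mem L _) (mul_mem (leftMul_mem L _) (leftMul_mem L _)) (by
    rw [leftMul_apply_one, Module.End.mul_apply, leftMul_apply_one])

noncomputable instance instRing : Ring (Hecke cs L) where
  __ := instAddCommGroup L
  mul x y := leftMul L x y
  one := T L 1
  left_distrib x y z := map_add (leftMul L x) y z
  right_distrib x y z := by
    change leftMul L (x + y) z = leftMul L x z + leftMul L y z
    rw [map_add, LinearMap.add_apply]
  zero_mul x := by
    change leftMul L 0 x = 0
    rw [map_zero, LinearMap.zero_apply]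
  mul_zero x := map_zero (leftMul L x)
  mul_assoc x y z := by
    change leftMul L (leftMul L x y) z = leftMul L x (leftMul L y z)
    rw [leftMul_leftMul, Module.End.mul_apply]
  one_mul x := by
    change leftMul L (T L 1) x = x
    rw [leftMul_one, Module.End.one_apply]
  mul_one x := leftMul_apply_one L x

theorem mul_def (x y : Hecke cs L) : x * y = leftMul L x y := rfl

theorem one_def : (1 : Hecke cs L) = T L 1 := rfl

noncomputable instance instAlgebra : Algebra (Ground Γ) (Hecke cs L) :=
  Algebra.ofModule
    (fun a x y => by rw [mul_def, mul_def, map_smul, LinearMap.smul_apply])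
    (fun a x y => by rw [mul_def, mul_def, map_smul])

theorem T_simple_mul (i : B) (x : Hecke cs L) : T L (cs.simple i) * x = lmul L i x := by
  rw [mul_def, ops_ext L (leftMul_mem L _) (Algebra.subset_adjoin ⟨i, rfl⟩)
    (g := lmul L i)]
  rw [leftMul_apply_one, lmul_up L (by simp), mul_one]

/-- First defining relation: `T_w T_{w'} = T_{ww'}` if `ℓ(ww') = ℓ(w) + ℓ(w')`. -/
theorem T_mul_T {w w' : W} (h : cs.length (w * w') = cs.length w + cs.length w') :
    T L w * T L w' = T L (w * w') := by
  rw [mul_def, leftMul_T, word_apply, redWord_prod]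
  rw [redWord_prod, h, ← (redWord_isReduced cs w).eq, redWord_prod]

/-- Second defining relation: `T_s² = 1 + (v^{L(s)} - v^{-L(s)}) T_s`. -/
theorem T_simple_sq (i : B) :
    T L (cs.simple i) ^ 2 = 1 + (vpow (L.toFun (cs.simple i)) - vpow (-L.toFun (cs.simple i))) •
      T L (cs.simple i) := by
  rw [pow_two, T_simple_mul, lmul_down L (by simp), cs.simple_mul_simple_self]
  rfl

theorem isUnit_T_simple (i : B) : IsUnit (T L (cs.simple i)) := by
  have h := T_simple_sq L i
  rw [pow_two] at h
  refine ⟨⟨T L (cs.simple i), T L (cs.simple i) - xi L i • 1, ?_, ?_⟩, rfl⟩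
  · rw [mul_sub, h, mul_smul_comm, mul_one, xi, add_sub_cancel_right]
  · rw [sub_mul, h, smul_mul_assoc, one_mul, xi, add_sub_cancel_right]

theorem isUnit_T (w : W) : IsUnit (T L w) := by
  obtain ⟨ω, hω, rfl⟩ := cs.exists_isReduced w
  induction ω with
  | nil => rw [cs.wordProd_nil, ← one_def]; exact isUnit_one
  | cons i ω ih =>
    have h1 : cs.length (cs.simple i * cs.wordProd ω) = ω.length + 1 := by
      simpa [CoxeterSystem.IsReduced, cs.wordProd_cons] using hω
    have h2 := cs.length_wordProd_le ω
    have h3 := cs.length_simple_mul (cs.wordProd ω) i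
    have hr : cs.IsReduced ω := by
      rw [CoxeterSystem.IsReduced]; omega
    rw [cs.wordProd_cons, ← T_mul_T L (by rw [h1, hr.eq, cs.length_simple]; omega)]
    exact (isUnit_T_simple L i).mul (ih hr)

/-- The coefficient of `h` on `T_w`. -/
noncomputable def coord (h : Hecke cs L) (w : W) : Ground Γ := (basis L).repr h w

/-- The bar involution: `∑ a_w T_w ↦ ∑ (bar a_w) T_{w⁻¹}⁻¹`. All `T_w` are units. -/
noncomputable def bar (h : Hecke cs L) : Hecke cs L :=
  ((basis L).repr h).sum fun w a => groundBar a • Ring.inverse (T L w⁻¹)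

/-- `c` is the Kazhdan--Lusztig element `C_w`: it is fixed by the bar involution
and lies in `T_w + ⊕_y A_{<0} T_y`. -/
def IsKazhdanLusztig (w : W) (c : Hecke cs L) : Prop :=
  bar L c = c ∧ ∀ y : W, IsNegative (coord L (c - T L w) y)

/-- The sub-`A`-algebra generated by the `T_s` with `s ∈ I`. -/
noncomputable def parabolic (I : Set B) : Subalgebra (Ground Γ) (Hecke cs L) :=
  Algebra.adjoin (Ground Γ) ((fun i => T L (cs.simple i)) '' I)

end Hecke

end Hecke

section TypeB

open Hecke

variable {n : ℕ} (hn : 1 ≤ n) {W : Type*} [Group W] (cs : CoxeterSystem (CoxeterMatrix.B n) W)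

/-- The index of the generator `t`, the end node of the double bond of the Dynkin diagram
of type `B_n`. The remaining indices are those of `s_1, …, s_{n-1}`. -/
def tIndex : Fin n := ⟨n - 1, by omega⟩

/-- `ℓ_t(w)`: the number of occurrences of `t` in a reduced expression of `w`. -/
noncomputable def lengthT (w : W) : ℕ := (redWord cs w).count (tIndex hn)

theorem signT_liftable : (CoxeterMatrix.B n).IsLiftable
    (fun i => Multiplicative.ofAdd (if i = tIndex hn then (1 : ZMod 2) else 0)) := by
  intro i j
  rw [← ofAdd_add, ← ofAdd_nsmul, ← ofAdd_zero]
  congr 1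
  rw [nsmul_eq_mul]
  by_cases hij : i = j
  · subst hij; simp [CharTwo.add_self_eq_zero]
  · have hM : (CoxeterMatrix.B n) i j =
        if i = j then 1
        else (if (i : ℕ) = n - 1 ∧ (j : ℕ) = n - 2 ∨ (j : ℕ) = n - 1 ∧ (i : ℕ) = n - 2 then 4
          else (if (j : ℕ) + 1 = i ∨ (i : ℕ) + 1 = j then 3 else 2)) := rfl
    rw [hM, if_neg hij]
    have h4 : (4 : ZMod 2) = 0 := rfl
    have h2 : (2 : ZMod 2) = 0 := rfl
    by_cases a : (i : ℕ) = n - 1 ∧ (j : ℕ) = n - 2 ∨ (j : ℕ) = n - 1 ∧ (i : ℕ) = n - 2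
    · rw [if_pos a, Nat.cast_ofNat, h4, zero_mul]
    · rw [if_neg a]
      by_cases b : (j : ℕ) + 1 = i ∨ (i : ℕ) + 1 = j
      · have hi : i ≠ tIndex hn := by
          simp only [tIndex, ne_eq, Fin.ext_iff] at *
          omega
        have hj : j ≠ tIndex hn := by
          simp only [tIndex, ne_eq, Fin.ext_iff] at *
          omega
        rw [if_neg hi, if_neg hj, add_zero, mul_zero]
      · rw [if_neg b, Nat.cast_ofNat, h2, zero_mul]

/-- The linear character of `W` (with values in `ℤ/2`) sending `t` to `1` and each `s_i` to `0`. -/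
noncomputable def signT : W →* Multiplicative (ZMod 2) :=
  cs.lift ⟨_, signT_liftable hn⟩

theorem signT_simple (i : Fin n) :
    signT hn cs (cs.simple i) = Multiplicative.ofAdd (if i = tIndex hn then 1 else 0) :=
  cs.lift_apply_simple _ i

theorem countP_rightInvSeq (ω : List (Fin n)) :
    (cs.rightInvSeq ω).countP (fun r => decide (signT hn cs r ≠ 1)) = ω.count (tIndex hn) := by
  induction ω with
  | nil => simp
  | cons i ω ih =>
    have h : signT hn cs ((cs.wordProd ω)⁻¹ * cs.simple i * cs.wordProd ω) ≠ 1 ↔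
        i = tIndex hn := by
      rw [map_mul, map_mul, map_inv, mul_comm, mul_inv_cancel_left, signT_simple]
      by_cases hi : i = tIndex hn <;> simp [hi]
    rw [CoxeterSystem.rightInvSeq, List.countP_cons, ih, List.count_cons]
    simp only [h, decide_eq_true_eq, beq_iff_eq]

/-- `ℓ_t(w)` can be computed from any reduced expression. -/
theorem lengthT_wordProd {ω : List (Fin n)} (h : cs.IsReduced ω) :
    lengthT hn cs (cs.wordProd ω) = ω.count (tIndex hn) := by
  rw [lengthT, ← countP_rightInvSeq hn cs ω, ← countP_rightInvSeq hn cs]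
  exact (rightInvSeq_perm cs (redWord_isReduced cs _) h (redWord_prod cs _)).countP_eq _

theorem lengthT_mul {w w' : W} (h : cs.length (w * w') = cs.length w + cs.length w') :
    lengthT hn cs (w * w') = lengthT hn cs w + lengthT hn cs w' := by
  obtain ⟨ω, hω, rfl⟩ := cs.exists_isReduced w
  obtain ⟨ω', hω', rfl⟩ := cs.exists_isReduced w'
  have hr : cs.IsReduced (ω ++ ω') := by
    rw [CoxeterSystem.IsReduced, cs.wordProd_append, h, hω.eq, hω'.eq, List.length_append]
  rw [← cs.wordProd_append, lengthT_wordProd hn cs hr, lengthT_wordProd hn cs hω,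
    lengthT_wordProd hn cs hω', List.count_append]

theorem lengthT_simple (i : Fin n) :
    lengthT hn cs (cs.simple i) = if i = tIndex hn then 1 else 0 := by
  have hr : cs.IsReduced [i] := by simp [CoxeterSystem.IsReduced]
  have := lengthT_wordProd hn cs hr
  rw [cs.wordProd_singleton] at this
  rw [this]
  simp [List.count_cons]

/-- The weight function `L_n(w) = (ℓ_t(w), ℓ_s(w))`, where `ℓ_s = ℓ - ℓ_t`, with values in `ℤ²`
ordered lexicographically. -/
noncomputable def weightB : WeightFunction cs (ℤ ×ₗ ℤ) where
  toFun w := toLex ((lengthT hn cs w : ℤ), (cs.length w : ℤ) - (lengthT hn cs w : ℤ))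
  map_mul' w w' h := by
    rw [← toLex_add, lengthT_mul hn cs h, h]
    congr 1
    ext
    · simp
    · simp; ring
  pos' i := by
    rw [lengthT_simple, cs.length_simple]
    split_ifs <;> decide

/-- The Hecke algebra `H_n = H(W_n, S_n, L_n)`. -/
abbrev HeckeB : Type _ := Hecke cs (weightB hn cs)

/-- The element `V = v^(1,0)` of the ground ring. -/
noncomputable def V : Ground (ℤ ×ₗ ℤ) := vpow (toLex ((1 : ℤ), (0 : ℤ)))

/-- The standard basis element `T_t`. -/
noncomputable def Tt : HeckeB hn cs := T (weightB hn cs) (cs.simple (tIndex hn))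

/-- `C_l`, the `A`-span of the Kazhdan--Lusztig elements `C_w` with `ℓ_t(w) = l`. -/
noncomputable def spanC (l : ℕ) : Submodule (Ground (ℤ ×ₗ ℤ)) (HeckeB hn cs) :=
  Submodule.span (Ground (ℤ ×ₗ ℤ))
    {c | ∃ w : W, lengthT hn cs w = l ∧ IsKazhdanLusztig (weightB hn cs) w c}

/-- `H(𝔖_n)`, the subalgebra generated by `T_{s_1}, …, T_{s_{n-1}}`. -/
noncomputable def heckeSym : Subalgebra (Ground (ℤ ×ₗ ℤ)) (HeckeB hn cs) :=
  parabolic (weightB hn cs) {i | i ≠ tIndex hn}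

end TypeB

end CoxeterHecke

/-!
Let `h` be annihilated by `(T_t - V) H(𝔖_n)`. Multiplying by a generator of `𝔖_n` preserves `ℓ_t`,
and any `w` with `ℓ_t(w) < n` is moved in this way to an element lengthened by `t`, where
`T_t h = V h` makes the coefficient of `h` equal to `V⁻¹` times the one at `t w`. By induction on
`n - ℓ_t(w)`, the coefficients on the `T_w` with `ℓ_t(w) = n` determine all others; and if those on
top have degree at most `0` in `V`, the others have negative degree in `V`, hence lie in `A_{<0}`
for the lexicographic order.

Conversely, all coefficients on top occur. The Jucys–Murphy elements
`L_i = T_{s_i} ⋯ T_{s_1} T_t T_{s_1} ⋯ T_{s_i}` commute pairwise and `∏ (L_i + V⁻¹)` commutes with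
`H(𝔖_n)`. Its factor `L_0 + V⁻¹ = T_t + V⁻¹` is killed by `T_t - V`, so the product lies in the
annihilator. Modulo the `T_w` with `ℓ_t(w) < n` it equals one `T_d` with `ℓ_t(d) = n`, and `d` is
moved by `𝔖_n` to every other `w` with `ℓ_t(w) = n`.

The annihilator is stable under the bar involution, so Lusztig's lemma gives it a canonical basis;
by the degree bound this basis consists of Kazhdan–Lusztig elements `C_w` with `ℓ_t(w) = n`.
-/

namespace CoxeterHecke

section GroundRing

variable {Γ : Type*} [AddCommGroup Γ]

theorem vpow_zero : vpow (0 : Γ) = 1 := rfl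

theorem vpow_add (γ δ : Γ) : vpow (γ + δ) = vpow γ * vpow δ := by
  rw [vpow, vpow, vpow, AddMonoidAlgebra.single_mul_single, one_mul]

theorem vpow_neg_mul_vpow (γ : Γ) : vpow (-γ) * vpow γ = 1 := by
  rw [← vpow_add, neg_add_cancel, vpow_zero]

theorem coeff_groundBar (a : Ground Γ) (γ : Γ) : (groundBar a).coeff γ = a.coeff (-γ) := by
  induction a using AddMonoidAlgebra.induction_linear with
  | zero => simp
  | add f g hf hg => simp [hf, hg]
  | single δ r =>
    classical
    simp [groundBar, Finsupp.single_apply, neg_eq_iff_eq_neg]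

theorem groundBar_involutive : Function.Involutive (groundBar (Γ := Γ)) := fun a => by
  ext γ; simp [coeff_groundBar]

theorem groundBar_vpow (γ : Γ) : groundBar (vpow γ) = vpow (-γ) := by
  ext δ
  classical
  simp [coeff_groundBar, vpow, Finsupp.single_apply, neg_eq_iff_eq_neg]

/-- The elements of the group algebra of `Γ` in which only exponents from `s` occur. The subgroup
`A_{<0}` of the predicate `IsNegative` is `exponentsIn (Set.Iio 0)`. -/
def exponentsIn (s : Set Γ) : AddSubgroup (Ground Γ) where
  carrier := {a | ∀ γ, a.coeff γ ≠ 0 → γ ∈ s}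
  zero_mem' := fun _ h => absurd rfl h
  add_mem' {a b} ha hb γ h := by
    by_cases haγ : a.coeff γ = 0
    · exact hb γ fun hbγ => h (by rw [AddMonoidAlgebra.coeff_add, Finsupp.add_apply, haγ, hbγ,
        add_zero])
    · exact ha γ haγ
  neg_mem' {a} ha γ h := ha γ fun haγ => h (by
    rw [AddMonoidAlgebra.coeff_neg, Finsupp.neg_apply, haγ, neg_zero])

theorem vpow_mem_exponentsIn {s : Set Γ} {γ : Γ} (h : γ ∈ s) : vpow γ ∈ exponentsIn s := by
  classical
  intro δ hδ
  rw [vpow, AddMonoidAlgebra.coeff_single, Finsupp.single_apply] at hδ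
  rwa [← of_not_not fun hne : ¬ γ = δ => hδ (if_neg hne)]

theorem vpow_mul_mem_exponentsIn {s s' : Set Γ} {γ : Γ} {a : Ground Γ} (ha : a ∈ exponentsIn s)
    (h : ∀ δ ∈ s, γ + δ ∈ s') : vpow γ * a ∈ exponentsIn s' := by
  intro δ hδ
  rw [vpow, AddMonoidAlgebra.coeff_single_mul_apply, one_mul] at hδ
  simpa using h _ (ha _ hδ)

variable [LinearOrder Γ]

theorem isNegative_iff {a : Ground Γ} : IsNegative a ↔ a ∈ exponentsIn (Set.Iio 0) := Iff.rfl

/-- The part of `a` with negative exponents. -/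
noncomputable def negativePart (a : Ground Γ) : Ground Γ :=
  AddMonoidAlgebra.ofCoeff (a.coeff.filter (· < 0))

theorem coeff_negativePart (a : Ground Γ) (γ : Γ) :
    (negativePart a).coeff γ = if γ < 0 then a.coeff γ else 0 := by
  rw [negativePart, AddMonoidAlgebra.coeff_ofCoeff, Finsupp.filter_apply]

theorem isNegative_negativePart (a : Ground Γ) : IsNegative (negativePart a) := by
  intro γ h
  rw [coeff_negativePart] at h
  exact of_not_not fun hγ => h (if_neg hγ)

theorem negativePart_zero : negativePart (0 : Ground Γ) = 0 := by
  ext γ; simp [coeff_negativePart]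

variable [IsOrderedAddMonoid Γ]

theorem IsNegative.eq_zero {a : Ground Γ} (ha : IsNegative a) (h : groundBar a = a) : a = 0 := by
  ext γ
  by_contra hγ
  have hneg : -γ < 0 := ha (-γ) (by rwa [← coeff_groundBar, h])
  exact lt_asymm (ha γ hγ) (neg_lt_zero.mp hneg)

theorem negativePart_sub_groundBar {a : Ground Γ} (h : groundBar a = -a) :
    negativePart a - groundBar (negativePart a) = a := by
  ext γ
  have hγ : a.coeff (-γ) = -a.coeff γ := by rw [← coeff_groundBar, h]; rfl
  rw [AddMonoidAlgebra.coeff_sub, Finsupp.sub_apply, coeff_groundBar, coeff_negativePart,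
    coeff_negativePart, hγ]
  rcases lt_trichotomy γ 0 with hlt | rfl | hgt
  · simp [hlt, hlt.le]
  · rw [neg_zero] at hγ
    simp only [neg_zero, lt_irrefl, if_false, sub_zero]
    omega
  · simp [hgt, hgt.le]

end GroundRing

section LusztigLemma

variable {Γ ι E : Type*} [AddCommGroup Γ] [AddCommGroup E] [Module (Ground Γ) E]

/-- The setting of Lusztig's lemma on canonical bases: the semilinear involution `ψ` is
unitriangular in the basis `b`, which is partially ordered by the rank `ℓ`. -/
structure IsUnitriangularInvolution (b : Module.Basis ι (Ground Γ) E)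
    (ψ : E →ₛₗ[groundBar (Γ := Γ)] E) (ℓ : ι → ℕ) : Prop where
  involutive : Function.Involutive ψ
  repr_sub_self : ∀ i j, ℓ i ≤ ℓ j → b.repr (ψ (b i) - b i) j = 0

/-- `c` is the canonical element attached to `i`: it is fixed by `ψ` and congruent to `b i` modulo
`⨁ A_{<0} b j`. For the standard basis of a Hecke algebra and the bar involution, this is
`IsKazhdanLusztig`. -/
def IsCanonical [LinearOrder Γ] (b : Module.Basis ι (Ground Γ) E)
    (ψ : E →ₛₗ[groundBar (Γ := Γ)] E) (i : ι) (c : E) : Prop :=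
  ψ c = c ∧ ∀ j, IsNegative (b.repr (c - b i) j)

namespace IsUnitriangularInvolution

variable {b : Module.Basis ι (Ground Γ) E} {ψ : E →ₛₗ[groundBar (Γ := Γ)] E} {ℓ : ι → ℕ}
  (hψ : IsUnitriangularInvolution b ψ ℓ)
include hψ

theorem repr_apply {x : E} {j : ι} (hx : ∀ i, b.repr x i ≠ 0 → ℓ i ≤ ℓ j) :
    b.repr (ψ x) j = groundBar (b.repr x j) := by
  have hspan : x ∈ Submodule.span (Ground Γ) (b '' {i | ℓ i ≤ ℓ j}) :=
    b.mem_span_image.mpr fun i hi => hx i (Finsupp.mem_support_iff.mp hi)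
  clear hx
  induction hspan using Submodule.span_induction with
  | mem x hx =>
    classical
    obtain ⟨i, hi, rfl⟩ := hx
    have hij := hψ.repr_sub_self i j hi
    rw [map_sub, Finsupp.sub_apply, sub_eq_zero] at hij
    rw [hij, b.repr_self_apply]
    split_ifs <;> simp
  | zero => simp
  | add x y _ _ hx hy => simp [hx, hy]
  | smul a x _ hx => simp [hx]

variable [LinearOrder Γ] [IsOrderedAddMonoid Γ]

theorem eq_zero_of_isNegative {x : E} (hfix : ψ x = x) (hx : ∀ j, IsNegative (b.repr x j)) :
    x = 0 := by
  by_contra hne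
  have hsupp : (b.repr x).support.Nonempty := by simpa using hne
  obtain ⟨j, hj, hmax⟩ := Finset.exists_max_image _ ℓ hsupp
  refine Finsupp.mem_support_iff.mp hj ((hx j).eq_zero ?_)
  rw [← hψ.repr_apply fun i hi => hmax i (Finsupp.mem_support_iff.mpr hi), hfix]

theorem isCanonical_unique {i : ι} {c c' : E} (hc : IsCanonical b ψ i c)
    (hc' : IsCanonical b ψ i c') : c = c' := by
  refine sub_eq_zero.mp (hψ.eq_zero_of_isNegative (by rw [map_sub, hc.1, hc'.1]) fun j => ?_)
  have hsub : c - c' = (c - b i) - (c' - b i) := by abel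
  rw [hsub, map_sub, Finsupp.sub_apply]
  exact sub_mem (isNegative_iff.mp (hc.2 j)) (isNegative_iff.mp (hc'.2 j))

theorem exists_sub_apply_eq (N : ℕ) {d : E} (hanti : ψ d = -d)
    (hd : ∀ j, N ≤ ℓ j → b.repr d j = 0) :
    ∃ p : E, p - ψ p = d ∧ (∀ j, IsNegative (b.repr p j)) ∧ ∀ j, N ≤ ℓ j → b.repr p j = 0 := by
  induction N generalizing d with
  | zero =>
    obtain rfl : d = 0 := b.ext_elem fun j => by simp [hd j (Nat.zero_le _)]
    exact ⟨0, by simp, fun j => by simpa using isNegative_iff.mpr (zero_mem _), by simp⟩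
  | succ N ih =>
    let q : E := b.repr.symm ((b.repr d).mapRange negativePart negativePart_zero)
    have hq (j : ι) : b.repr q j = negativePart (b.repr d j) := by simp [q]
    have hq_top (j : ι) (hj : N + 1 ≤ ℓ j) : b.repr q j = 0 := by
      rw [hq, hd j hj, negativePart_zero]
    have hle {x : E} (hx : ∀ i, N + 1 ≤ ℓ i → b.repr x i = 0) {j : ι} (hj : N ≤ ℓ j) (i : ι)
        (hi : b.repr x i ≠ 0) : ℓ i ≤ ℓ j := by
      by_contra! hlt
      exact hi (hx i (by omega))
    have hanti' : ψ (d - (q - ψ q)) = -(d - (q - ψ q)) := by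
      rw [map_sub, map_sub, hψ.involutive, hanti]; abel
    have hd' (j : ι) (hj : N ≤ ℓ j) : b.repr (d - (q - ψ q)) j = 0 := by
      have hbar : groundBar (b.repr d j) = -b.repr d j := by
        rw [← hψ.repr_apply (hle hd hj), hanti, map_neg, Finsupp.neg_apply]
      simp only [map_sub, Finsupp.sub_apply]
      rw [hψ.repr_apply (hle hq_top hj), hq, negativePart_sub_groundBar hbar, sub_self]
    obtain ⟨p, hp, hneg, htop⟩ := ih hanti' hd'
    refine ⟨p + q, ?_, fun j => ?_, fun j hj => ?_⟩
    · rw [map_add, add_sub_add_comm, hp]; abel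
    · rw [map_add, Finsupp.add_apply, hq]
      exact add_mem (isNegative_iff.mp (hneg j)) (isNegative_iff.mp (isNegative_negativePart _))
    · rw [map_add, Finsupp.add_apply, htop j (by omega), hq_top j hj, add_zero]

theorem exists_isCanonical (i : ι) :
    ∃ c, IsCanonical b ψ i c ∧ ∀ j, ℓ i ≤ ℓ j → b.repr (c - b i) j = 0 := by
  obtain ⟨p, hp, hneg, htop⟩ := hψ.exists_sub_apply_eq (ℓ i) (d := ψ (b i) - b i)
    (by rw [map_sub, hψ.involutive]; abel) (hψ.repr_sub_self i)
  refine ⟨b i + p, ⟨?_, by simpa using hneg⟩, by simpa using htop⟩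
  rw [map_add, ← sub_sub_cancel p (ψ p), hp]
  abel

theorem span_isCanonical :
    Submodule.span (Ground Γ) {c | ∃ i, IsCanonical b ψ i c} = ⊤ := by
  rw [← top_le_iff, ← b.span_eq, Submodule.span_le, Set.range_subset_iff]
  intro i
  induction h : ℓ i using Nat.strong_induction_on generalizing i with
  | _ N ih =>
    subst h
    obtain ⟨c, hc, htop⟩ := hψ.exists_isCanonical i
    have hlow : c - b i ∈ Submodule.span (Ground Γ) {c | ∃ i, IsCanonical b ψ i c} := by
      refine Submodule.span_le.mpr ?_ (b.mem_span_image (s := {j | ℓ j < ℓ i}).mpr ?_)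
      · rintro - ⟨j, hj, rfl⟩
        exact ih (ℓ j) hj j rfl
      · intro j hj
        by_contra! hji
        exact Finsupp.mem_support_iff.mp hj (htop j (by simpa using hji))
    rw [← sub_sub_cancel c (b i)]
    exact sub_mem (Submodule.subset_span ⟨i, hc⟩) hlow

end IsUnitriangularInvolution

end LusztigLemma

section Coxeter

variable {B W : Type*} [Group W] {M : CoxeterMatrix B} (cs : CoxeterSystem M W)

/-- The parity `N(w, r)` of the number of occurrences of `r` among the right inversions of a word
of `w`; the action of `w` on `W × ℤ/2` extending `reflFlip` is `(r, e) ↦ (w r w⁻¹, e + N(w, r))`. -/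
noncomputable def invParity (w r : W) : ZMod 2 :=
  (cs.lift ⟨reflFlip cs, reflFlip_liftable cs⟩ w (r, 0)).2

open Classical in
theorem invParity_wordProd (ω : List B) (r : W) :
    invParity cs (cs.wordProd ω) r = ((cs.rightInvSeq ω).count r : ℕ) := by
  rw [invParity, lift_reflFlip_wordProd, zero_add]

theorem invParity_one (r : W) : invParity cs 1 r = 0 := by
  simpa using invParity_wordProd cs [] r

open Classical in
theorem invParity_simple (i : B) (r : W) :
    invParity cs (cs.simple i) r = if r = cs.simple i then 1 else 0 := by
  have h := invParity_wordProd cs [i] r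
  simp only [cs.wordProd_singleton, cs.rightInvSeq_singleton, List.count_singleton, beq_iff_eq,
    Nat.cast_ite, Nat.cast_one, Nat.cast_zero, eq_comm (b := r)] at h
  exact h

theorem invParity_mul (x y r : W) :
    invParity cs (x * y) r = invParity cs y r + invParity cs x (y * r * y⁻¹) := by
  obtain ⟨ω, rfl⟩ := cs.wordProd_surjective x
  obtain ⟨ω', rfl⟩ := cs.wordProd_surjective y
  classical
  rw [invParity, map_mul, Equiv.Perm.mul_apply, lift_reflFlip_wordProd, lift_reflFlip_wordProd,
    invParity_wordProd, invParity_wordProd, zero_add]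

theorem invParity_eq_one_iff {ω : List B} (h : cs.IsReduced ω) (r : W) :
    invParity cs (cs.wordProd ω) r = 1 ↔ r ∈ cs.rightInvSeq ω := by
  classical
  rw [invParity_wordProd]
  by_cases hr : r ∈ cs.rightInvSeq ω
  · simp [hr, List.count_eq_one_of_mem (h.nodup_rightInvSeq cs) hr]
  · simp [hr, List.count_eq_zero_of_not_mem hr]

theorem invParity_ne_one_iff (w r : W) : invParity cs w r ≠ 1 ↔ invParity cs w r = 0 := by
  generalize invParity cs w r = e
  revert e
  decide

theorem length_mul_lt_of_invParity_eq_one {w r : W} (h : invParity cs w r = 1) :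
    cs.length (w * r) < cs.length w := by
  obtain ⟨ω, hω, rfl⟩ := cs.exists_isReduced w
  exact (cs.isRightInversion_of_mem_rightInvSeq hω ((invParity_eq_one_iff cs hω r).mp h)).2

theorem length_mul_simple_lt_iff (w : W) (i : B) :
    cs.length (w * cs.simple i) < cs.length w ↔ invParity cs w (cs.simple i) = 1 := by
  refine ⟨fun h => ?_, length_mul_lt_of_invParity_eq_one cs⟩
  by_contra hne
  have hflip : invParity cs (w * cs.simple i) (cs.simple i) = 1 := by
    rw [invParity_mul, mul_inv_cancel_right, (invParity_ne_one_iff cs _ _).mp hne,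
      invParity_simple, if_pos rfl, add_zero]
  have hlt := length_mul_lt_of_invParity_eq_one cs hflip
  rw [cs.simple_mul_simple_cancel_right] at hlt
  exact lt_asymm h hlt

/-- The standard parabolic subgroup `W_I`. -/
def parabolicSubgroup (I : Set B) : Subgroup W :=
  Subgroup.closure (cs.simple '' I)

variable {cs} {I : Set B}

theorem simple_mem_parabolicSubgroup {i : B} (hi : i ∈ I) :
    cs.simple i ∈ parabolicSubgroup cs I :=
  Subgroup.subset_closure ⟨i, hi, rfl⟩

theorem wordProd_mem_parabolicSubgroup {ω : List B} (hω : ∀ i ∈ ω, i ∈ I) :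
    cs.wordProd ω ∈ parabolicSubgroup cs I := by
  refine list_prod_mem fun x hx => ?_
  obtain ⟨i, hi, rfl⟩ := List.mem_map.mp hx
  exact simple_mem_parabolicSubgroup (hω i hi)

@[elab_as_elim]
theorem parabolicSubgroup_induction_left {p : (w : W) → w ∈ parabolicSubgroup cs I → Prop}
    (one : p 1 (one_mem _))
    (simple_mul : ∀ i (hi : i ∈ I) w (hw : w ∈ parabolicSubgroup cs I), p w hw →
      p (cs.simple i * w) (mul_mem (simple_mem_parabolicSubgroup hi) hw))
    {w : W} (hw : w ∈ parabolicSubgroup cs I) : p w hw := by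
  induction hw using Subgroup.closure_induction_left with
  | one => exact one
  | mul_left x hx y hy ih =>
    obtain ⟨i, hi, rfl⟩ := hx
    exact simple_mul i hi y hy ih
  | inv_mul_cancel x hx y hy ih =>
    obtain ⟨i, hi, rfl⟩ := hx
    simpa only [cs.inv_simple] using simple_mul i hi y hy ih

@[elab_as_elim]
theorem parabolicSubgroup_induction_right {p : (w : W) → w ∈ parabolicSubgroup cs I → Prop}
    (one : p 1 (one_mem _))
    (mul_simple : ∀ w (hw : w ∈ parabolicSubgroup cs I) i (hi : i ∈ I), p w hw →
      p (w * cs.simple i) (mul_mem hw (simple_mem_parabolicSubgroup hi)))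
    {w : W} (hw : w ∈ parabolicSubgroup cs I) : p w hw := by
  induction hw using Subgroup.closure_induction_right with
  | one => exact one
  | mul_right x hx y hy ih =>
    obtain ⟨i, hi, rfl⟩ := hy
    exact mul_simple x hx i hi ih
  | mul_inv_cancel x hx y hy ih =>
    obtain ⟨i, hi, rfl⟩ := hy
    simpa only [cs.inv_simple] using mul_simple x hx i hi ih

theorem mem_parabolicSubgroup_of_invParity_eq_one {x r : W} (hx : x ∈ parabolicSubgroup cs I)
    (h : invParity cs x r = 1) : r ∈ parabolicSubgroup cs I := by
  classical
  induction hx using parabolicSubgroup_induction_right generalizing r with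
  | one => exact absurd (invParity_one cs r ▸ h) (by decide)
  | mul_simple x _ i hi ih =>
    have hs := simple_mem_parabolicSubgroup (cs := cs) hi
    rw [invParity_mul, invParity_simple] at h
    split_ifs at h with hr
    · rwa [hr]
    · rw [zero_add] at h
      have hconj := ih h
      rwa [Subgroup.mul_mem_cancel_right _ (inv_mem hs), Subgroup.mul_mem_cancel_left _ hs]
        at hconj

/-- If `N(x, -)` vanishes on `W_I`, then `x` does not affect the descents of elements of `W_I`. -/
theorem length_mul_of_forall_le {x y : W}
    (hx : ∀ z ∈ parabolicSubgroup cs I, cs.length x ≤ cs.length (x * z))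
    (hy : y ∈ parabolicSubgroup cs I) : cs.length (x * y) = cs.length x + cs.length y := by
  induction hy using parabolicSubgroup_induction_right with
  | one => simp
  | mul_simple y hy i hi ih =>
    have hzero : invParity cs x (y * cs.simple i * y⁻¹) = 0 := by
      rw [← invParity_ne_one_iff]
      intro h
      exact (hx _ (mul_mem (mul_mem hy (simple_mem_parabolicSubgroup hi)) (inv_mem hy))).not_gt
        (length_mul_lt_of_invParity_eq_one cs h)
    have hdescent : cs.length (x * y * cs.simple i) < cs.length (x * y) ↔
        cs.length (y * cs.simple i) < cs.length y := by
      rw [length_mul_simple_lt_iff, length_mul_simple_lt_iff, invParity_mul, hzero, add_zero]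
    have hxy := cs.length_mul_simple (x * y) i
    have hy' := cs.length_mul_simple y i
    rw [← mul_assoc]
    omega

end Coxeter

section BraidRelations

/-- The Jucys–Murphy products `L_0 = g 0`, `L_{i+1} = g (i+1) * L_i * g (i+1)`. -/
def jucysMurphy {G : Type*} [Mul G] (g : ℕ → G) : ℕ → G
  | 0 => g 0
  | i + 1 => g (i + 1) * jucysMurphy g i * g (i + 1)

/-- The descending product `f (m - 1) * ⋯ * f 0`. -/
def descProd {G : Type*} [Monoid G] (f : ℕ → G) : ℕ → G
  | 0 => 1
  | m + 1 => f m * descProd f m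

/-- The braid relations of type `B_n` for elements `g 0, …, g (n - 1)`, numbered along the Dynkin
diagram so that the double bond joins `g 0` and `g 1`. -/
structure IsBraidB {G : Type*} [Mul G] (n : ℕ) (g : ℕ → G) : Prop where
  four : 1 < n → g 0 * g 1 * g 0 * g 1 = g 1 * g 0 * g 1 * g 0
  three : ∀ i, 1 ≤ i → i + 1 < n → g i * g (i + 1) * g i = g (i + 1) * g i * g (i + 1)
  comm : ∀ i j, i + 1 < j → j < n → Commute (g i) (g j)

namespace IsBraidB

variable {G : Type*} [Monoid G] {n : ℕ} {g : ℕ → G}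

theorem commute_of_lt (h : IsBraidB n g) {i j : ℕ} (hij : i + 1 < j) (hj : j < n) :
    Commute (g j) (jucysMurphy g i) := by
  induction i with
  | zero => exact (h.comm 0 j hij hj).symm
  | succ i ih =>
    have hcomm := (h.comm (i + 1) j hij hj).symm
    exact (hcomm.mul_right (ih (by omega))).mul_right hcomm

theorem commute_succ (h : IsBraidB n g) {j : ℕ} (hj : j + 1 < n) :
    Commute (g j) (jucysMurphy g (j + 1)) := by
  cases j with
  | zero =>
    have hfour := h.four hj
    simp only [jucysMurphy, Commute, SemiconjBy, zero_add, mul_assoc] at hfour ⊢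
    exact hfour
  | succ j =>
    have hbraid := h.three (j + 1) (by omega) hj
    have hcomm := h.commute_of_lt (i := j) (j := j + 2) (by omega) hj
    simp only [jucysMurphy, Commute, SemiconjBy] at hbraid hcomm ⊢
    calc g (j + 1) * (g (j + 2) * (g (j + 1) * jucysMurphy g j * g (j + 1)) * g (j + 2))
        = (g (j + 1) * g (j + 2) * g (j + 1)) * jucysMurphy g j * g (j + 1) * g (j + 2) := by
          simp only [mul_assoc]
      _ = g (j + 2) * g (j + 1) * (g (j + 2) * jucysMurphy g j) * g (j + 1) * g (j + 2) := by
          rw [hbraid]; simp only [mul_assoc]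
      _ = g (j + 2) * g (j + 1) * jucysMurphy g j * (g (j + 2) * g (j + 1) * g (j + 2)) := by
          rw [hcomm]; simp only [mul_assoc]
      _ = g (j + 2) * (g (j + 1) * jucysMurphy g j * g (j + 1)) * g (j + 2) * g (j + 1) := by
          rw [← hbraid]; simp only [mul_assoc]

theorem commute_of_gt (h : IsBraidB n g) {i j : ℕ} (hij : j < i) (hi : i < n) :
    Commute (g j) (jucysMurphy g i) := by
  induction i with
  | zero => omega
  | succ i ih =>
    rcases Nat.lt_succ_iff_lt_or_eq.mp hij with hlt | rfl
    · have hcomm := h.comm j (i + 1) (by omega) hi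
      exact (hcomm.mul_right (ih hlt (by omega))).mul_right hcomm
    · exact h.commute_succ hi

theorem jucysMurphy_commute_of_lt (h : IsBraidB n g) {i j : ℕ} (hij : i < j) (hj : j < n) :
    Commute (jucysMurphy g i) (jucysMurphy g j) := by
  induction i with
  | zero => exact h.commute_of_gt hij hj
  | succ i ih =>
    have hcomm := h.commute_of_gt hij hj
    exact (hcomm.mul_left (ih (by omega))).mul_left hcomm

end IsBraidB

theorem coxeterMatrixB_apply {n : ℕ} (i j : Fin n) :
    CoxeterMatrix.B n i j =
      if (i.rev : ℕ) = j.rev then 1 else if (i.rev + j.rev : ℕ) = 1 then 4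
      else if (i.rev + 1 : ℕ) = j.rev ∨ (j.rev + 1 : ℕ) = i.rev then 3 else 2 := by
  have hB : CoxeterMatrix.B n i j = if i = j then 1
    else if (i : ℕ) = n - 1 ∧ (j : ℕ) = n - 2 ∨ (j : ℕ) = n - 1 ∧ (i : ℕ) = n - 2 then 4
    else if (j : ℕ) + 1 = i ∨ (i : ℕ) + 1 = j then 3 else 2 := rfl
  rw [hB]
  have hi := i.isLt
  have hj := j.isLt
  simp only [Fin.ext_iff, Fin.val_rev]
  split_ifs <;> omega

section Involutions

variable {G : Type*} [Group G] {a b : G}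

theorem mul_pow_two_eq_one_iff (ha : a * a = 1) (hb : b * b = 1) :
    (a * b) ^ 2 = 1 ↔ Commute a b := by
  rw [pow_two, mul_eq_one_iff_eq_inv, mul_inv_rev, inv_eq_of_mul_eq_one_left ha,
    inv_eq_of_mul_eq_one_left hb, commute_iff_eq]

theorem mul_pow_three_eq_one_iff (ha : a * a = 1) (hb : b * b = 1) :
    (a * b) ^ 3 = 1 ↔ a * b * a = b * a * b := by
  have hpow : (a * b) ^ 3 = a * b * a * (b * a * b) := by
    simp only [pow_succ, pow_zero, one_mul, mul_assoc]
  rw [hpow, mul_eq_one_iff_eq_inv, mul_inv_rev, mul_inv_rev, inv_eq_of_mul_eq_one_left ha,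
    inv_eq_of_mul_eq_one_left hb, mul_assoc b]

theorem mul_pow_four_eq_one_iff (ha : a * a = 1) (hb : b * b = 1) :
    (a * b) ^ 4 = 1 ↔ a * b * a * b = b * a * b * a := by
  have hpow : (a * b) ^ 4 = a * b * a * b * (a * b * a * b) := by
    simp only [pow_succ, pow_zero, one_mul, mul_assoc]
  rw [hpow, mul_eq_one_iff_eq_inv, mul_inv_rev, mul_inv_rev, mul_inv_rev,
    inv_eq_of_mul_eq_one_left ha, inv_eq_of_mul_eq_one_left hb, ← mul_assoc, ← mul_assoc]

theorem isBraidB_iff_isLiftable {n : ℕ} {g : ℕ → G} (hg : ∀ i, g i * g i = 1) :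
    IsBraidB n g ↔ (CoxeterMatrix.B n).IsLiftable fun i : Fin n => g i.rev := by
  constructor
  · intro h i j
    have hi := i.rev.isLt
    have hj := j.rev.isLt
    rw [coxeterMatrixB_apply]
    dsimp only
    generalize (i.rev : ℕ) = a at *
    generalize (j.rev : ℕ) = b at *
    split_ifs with heq hfour hthree
    · rw [heq, pow_one, hg]
    · rw [mul_pow_four_eq_one_iff (hg a) (hg b)]
      obtain ⟨rfl, rfl⟩ | ⟨rfl, rfl⟩ : a = 0 ∧ b = 1 ∨ a = 1 ∧ b = 0 := by omega
      exacts [h.four hj, (h.four hi).symm]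
    · rw [mul_pow_three_eq_one_iff (hg a) (hg b)]
      rcases hthree with rfl | rfl
      exacts [h.three a (by omega) hj, (h.three b (by omega) hi).symm]
    · rw [mul_pow_two_eq_one_iff (hg a) (hg b)]
      rcases Nat.lt_or_gt_of_ne heq with hlt | hlt
      exacts [h.comm a b (by omega) hj, (h.comm b a (by omega) hi).symm]
  · intro h
    have hpow (i j : ℕ) (hi : i < n) (hj : j < n) := by
      simpa only [coxeterMatrixB_apply, Fin.rev_rev] using h (Fin.rev ⟨i, hi⟩) (Fin.rev ⟨j, hj⟩)
    refine ⟨fun hn => ?_, fun i hi hn => ?_, fun i j hij hj => ?_⟩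
    · rw [← mul_pow_four_eq_one_iff (hg _) (hg _)]
      simpa using hpow 0 1 (by omega) hn
    · rw [← mul_pow_three_eq_one_iff (hg _) (hg _)]
      simpa [show i + (i + 1) ≠ 1 by omega] using hpow i (i + 1) (by omega) hn
    · rw [← mul_pow_two_eq_one_iff (hg _) (hg _)]
      simpa [show i ≠ j by omega, show i + j ≠ 1 by omega, show i + 1 ≠ j by omega,
        show j + 1 ≠ i by omega] using hpow i j (by omega) hj

end Involutions

end BraidRelations

section SignedPermutations

theorem signedGen_involutive (j : ℕ) : Function.Involutive fun p : ℤ =>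
    if p = j - 1 ∨ p = -1 - j then p + 1 else if p = j ∨ p = -j then p - 1 else p := by
  intro p
  grind

/-- The generators of the group of signed permutations, acting on `ℤ` with sign change
`p ↦ -1 - p`: for `j > 0` the generator exchanges `j - 1` and `j` (and their negatives), and for
`j = 0` it exchanges `0` with its negative `-1`. -/
def signedGen (j : ℕ) : Equiv.Perm ℤ :=
  (signedGen_involutive j).toPerm

theorem signedGen_apply (j : ℕ) (p : ℤ) :
    signedGen j p =
      if p = j - 1 ∨ p = -1 - j then p + 1 else if p = j ∨ p = -j then p - 1 else p := rfl

theorem signedGen_apply_of_lt {j : ℕ} {p : ℤ} (h : j < p) : signedGen j p = p := by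
  rw [signedGen_apply, if_neg (by omega), if_neg (by omega)]

theorem signedGen_mul_self (j : ℕ) : signedGen j * signedGen j = 1 :=
  Equiv.ext (signedGen_involutive j)

theorem abs_signedGen_apply_sub_le (j : ℕ) (p : ℤ) : |signedGen j p - p| ≤ 1 := by
  rw [signedGen_apply, abs_le]
  split_ifs <;> omega

theorem signedGen_isBraidB (n : ℕ) : IsBraidB n signedGen where
  four _ := by
    ext p
    simp only [Equiv.Perm.mul_apply, signedGen_apply, Nat.cast_zero, Nat.cast_one]
    grind
  three i hi _ := by
    ext p
    simp only [Equiv.Perm.mul_apply, signedGen_apply, Nat.cast_add, Nat.cast_one]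
    grind
  comm i j hij _ := by
    ext p
    simp only [Equiv.Perm.mul_apply, signedGen_apply]
    grind

theorem jucysMurphy_signedGen (j : ℕ) :
    jucysMurphy signedGen j = Equiv.swap (j : ℤ) (-1 - j) := by
  induction j with
  | zero =>
    ext p
    simp only [jucysMurphy, signedGen_apply, Equiv.swap_apply_def]
    grind
  | succ j ih =>
    have hpos : signedGen (j + 1) (j : ℤ) = (j + 1 : ℕ) := by
      rw [signedGen_apply, if_pos (by omega)]; simp
    have hneg : signedGen (j + 1) (-1 - j : ℤ) = -1 - (j + 1 : ℕ) := by
      rw [signedGen_apply, if_neg (by omega), if_pos (by omega)]; push_cast; ring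
    rw [jucysMurphy, ih, Equiv.mul_swap_eq_swap_mul, hpos, hneg, mul_assoc, signedGen_mul_self,
      mul_one]

end SignedPermutations

section WeylGroupB

variable {n : ℕ} (hn : 1 ≤ n) {W : Type*} [Group W] (cs : CoxeterSystem (CoxeterMatrix.B n) W)

/-- The index of the node of the Dynkin diagram at distance `j` from `t`; only meaningful for
`j < n`. -/
def nodeIndex (j : ℕ) : Fin n := ⟨n - 1 - j, by omega⟩

theorem rev_nodeIndex {j : ℕ} (hj : j < n) : ((nodeIndex hn j).rev : ℕ) = j := by
  rw [Fin.val_rev, nodeIndex]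
  dsimp only
  omega

theorem nodeIndex_rev (i : Fin n) : nodeIndex hn i.rev = i := by
  ext
  rw [nodeIndex, Fin.val_rev]
  dsimp only
  omega

theorem nodeIndex_ne_tIndex {j : ℕ} (h0 : 0 < j) (hj : j < n) : nodeIndex hn j ≠ tIndex hn := by
  rw [nodeIndex, tIndex, ne_eq, Fin.ext_iff]
  dsimp only
  omega

/-- The generators `t = node 0` and `s_j = node j`, for `0 < j < n`. -/
def node (j : ℕ) : W := cs.simple (nodeIndex hn j)

theorem node_mul_self (j : ℕ) : node hn cs j * node hn cs j = 1 :=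
  cs.simple_mul_simple_self _

theorem node_isBraidB : IsBraidB n (node hn cs) :=
  (isBraidB_iff_isLiftable (node_mul_self hn cs)).mpr fun i j => by
    simpa only [node, nodeIndex_rev] using cs.simple_mul_simple_pow i j

/-- The action of `W_n` by signed permutations, with `t` changing the sign of `0` and `s_j`
exchanging `j - 1` and `j`. -/
def signedPerm : W →* Equiv.Perm ℤ :=
  cs.lift ⟨_, (isBraidB_iff_isLiftable signedGen_mul_self).mp (signedGen_isBraidB n)⟩

theorem signedPerm_simple (i : Fin n) : signedPerm cs (cs.simple i) = signedGen i.rev :=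
  cs.lift_apply_simple _ i

theorem signedPerm_node {j : ℕ} (hj : j < n) : signedPerm cs (node hn cs j) = signedGen j := by
  rw [node, signedPerm_simple, rev_nodeIndex hn hj]

theorem abs_signedPerm_apply_sub_le_length (w : W) (p : ℤ) :
    |signedPerm cs w p - p| ≤ cs.length w := by
  obtain ⟨ω, hω, rfl⟩ := cs.exists_isReduced w
  rw [hω.eq]
  clear hω
  induction ω with
  | nil => simp
  | cons i ω ih =>
    rw [cs.wordProd_cons, map_mul, Equiv.Perm.mul_apply, signedPerm_simple, List.length_cons,
      Nat.cast_succ, add_comm]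
    exact (abs_sub_le _ _ _).trans (add_le_add (abs_signedGen_apply_sub_le _ _) ih)

variable {cs} in
/-- Every element of the coset of `x` modulo the generators fixing `p` moves `p` equally far, so `x`
has minimal length in it. -/
theorem length_mul_of_length_le_displacement {x y : W} (p : ℤ)
    (hx : (cs.length x : ℤ) ≤ |signedPerm cs x p - p|)
    (hy : y ∈ parabolicSubgroup cs {i | signedPerm cs (cs.simple i) p = p}) :
    cs.length (x * y) = cs.length x + cs.length y := by
  refine length_mul_of_forall_le (fun z hz => ?_) hy
  have hfix : signedPerm cs z p = p := by
    induction hz using parabolicSubgroup_induction_left with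
    | one => simp
    | simple_mul i hi z hz ih => rw [map_mul, Equiv.Perm.mul_apply, ih]; exact hi
  have hxz := abs_signedPerm_apply_sub_le_length cs (x * z) p
  rw [map_mul, Equiv.Perm.mul_apply, hfix] at hxz
  exact_mod_cast hx.trans hxz

theorem node_mem_parabolicSubgroup_of_lt {j : ℕ} {p : ℤ} (hj : j < n) (hp : j < p) :
    node hn cs j ∈ parabolicSubgroup cs {i | signedPerm cs (cs.simple i) p = p} := by
  refine simple_mem_parabolicSubgroup ?_
  rw [Set.mem_ofPred_eq, signedPerm_simple, rev_nodeIndex hn hj, signedGen_apply_of_lt hp]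

theorem jucysMurphy_mem_parabolicSubgroup_of_lt {j : ℕ} {p : ℤ} (hj : j < n) (hp : j < p) :
    jucysMurphy (node hn cs) j ∈
      parabolicSubgroup cs {i | signedPerm cs (cs.simple i) p = p} := by
  induction j with
  | zero => exact node_mem_parabolicSubgroup_of_lt hn cs hj hp
  | succ j ih =>
    have hnode := node_mem_parabolicSubgroup_of_lt hn cs hj hp
    exact mul_mem (mul_mem hnode (ih (by omega) (by omega))) hnode

theorem signedPerm_jucysMurphy {j : ℕ} (hj : j < n) :
    signedPerm cs (jucysMurphy (node hn cs) j) = jucysMurphy signedGen j := by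
  induction j with
  | zero => exact signedPerm_node hn cs hj
  | succ j ih => simp only [jucysMurphy, map_mul, ih (by omega), signedPerm_node hn cs hj]

theorem abs_signedPerm_jucysMurphy_sub {j : ℕ} (hj : j < n) :
    |signedPerm cs (jucysMurphy (node hn cs) j) j - j| = 2 * j + 1 := by
  rw [signedPerm_jucysMurphy hn cs hj, jucysMurphy_signedGen, Equiv.swap_apply_left, abs_eq] <;>
  omega

theorem length_jucysMurphy {j : ℕ} (hj : j < n) :
    cs.length (jucysMurphy (node hn cs) j) = 2 * j + 1 := by
  refine le_antisymm ?_ ?_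
  · clear hj
    induction j with
    | zero => exact (cs.length_simple _).le
    | succ j ih =>
      have hleft := cs.length_mul_le (node hn cs (j + 1)) (jucysMurphy (node hn cs) j)
      have hright := cs.length_mul_le (node hn cs (j + 1) * jucysMurphy (node hn cs) j)
        (node hn cs (j + 1))
      have hnode : cs.length (node hn cs (j + 1)) = 1 := cs.length_simple _
      rw [jucysMurphy]
      omega
  · have hdisp := abs_signedPerm_apply_sub_le_length cs (jucysMurphy (node hn cs) j) j
    rw [abs_signedPerm_jucysMurphy_sub hn cs hj] at hdisp
    omega

theorem length_jucysMurphy_mul {j : ℕ} (hj : j < n) {y : W}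
    (hy : y ∈ parabolicSubgroup cs {i | signedPerm cs (cs.simple i) j = j}) :
    cs.length (jucysMurphy (node hn cs) j * y) =
      cs.length (jucysMurphy (node hn cs) j) + cs.length y := by
  refine length_mul_of_length_le_displacement j ?_ hy
  rw [abs_signedPerm_jucysMurphy_sub hn cs hj, length_jucysMurphy hn cs hj]
  push_cast
  rfl

theorem length_descProd_succ {m : ℕ} (hm : m < n) :
    cs.length (descProd (jucysMurphy (node hn cs)) (m + 1)) =
      cs.length (jucysMurphy (node hn cs) m) +
        cs.length (descProd (jucysMurphy (node hn cs)) m) := by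
  refine length_jucysMurphy_mul hn cs hm ?_
  suffices ∀ k ≤ m, descProd (jucysMurphy (node hn cs)) k ∈
      parabolicSubgroup cs {i | signedPerm cs (cs.simple i) m = m} from this m le_rfl
  intro k hk
  induction k with
  | zero => exact one_mem _
  | succ k ih =>
    exact mul_mem (jucysMurphy_mem_parabolicSubgroup_of_lt hn cs (by omega) (by omega))
      (ih (by omega))

theorem length_node_mul_node_mul_node {i : ℕ} (hin : i + 1 < n) :
    cs.length (node hn cs i * node hn cs (i + 1) * node hn cs i) = 3 := by
  set x := node hn cs i * node hn cs (i + 1) with hx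
  have hnode (j : ℕ) : cs.length (node hn cs j) = 1 := cs.length_simple _
  have hle : cs.length x ≤ 2 := by
    simpa only [hnode] using cs.length_mul_le (node hn cs i) (node hn cs (i + 1))
  have hdisp : |signedPerm cs x (i + 1 : ℕ) - (i + 1 : ℕ)| = 2 := by
    rw [hx, map_mul, Equiv.Perm.mul_apply, signedPerm_node hn cs hin,
      signedPerm_node hn cs (by omega), signedGen_apply, signedGen_apply, abs_eq (by norm_num)]
    grind
  have hge := abs_signedPerm_apply_sub_le_length cs x (i + 1 : ℕ)
  rw [length_mul_of_length_le_displacement (i + 1 : ℕ) (by rw [hdisp]; exact_mod_cast hle)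
    (node_mem_parabolicSubgroup_of_lt hn cs (by omega) (by push_cast; omega)), hnode]
  omega

/-- The subgroup `𝔖_n` generated by `s_1, …, s_{n-1}`. -/
abbrev symSubgroup : Subgroup W := parabolicSubgroup cs {i | i ≠ tIndex hn}

theorem node_mem_symSubgroup {j : ℕ} (h0 : 0 < j) (hj : j < n) :
    node hn cs j ∈ symSubgroup hn cs :=
  simple_mem_parabolicSubgroup (nodeIndex_ne_tIndex hn h0 hj)

theorem exists_jucysMurphy_eq_conj {m : ℕ} (hm : m < n) : ∃ x ∈ symSubgroup hn cs,
    jucysMurphy (node hn cs) m = x⁻¹ * cs.simple (tIndex hn) * x := by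
  induction m with
  | zero => exact ⟨1, one_mem _, by simp only [inv_one, one_mul, mul_one]; rfl⟩
  | succ m ih =>
    obtain ⟨x, hx, hconj⟩ := ih (by omega)
    refine ⟨x * node hn cs (m + 1), mul_mem hx (node_mem_symSubgroup hn cs (by omega) hm), ?_⟩
    rw [jucysMurphy, hconj, mul_inv_rev, inv_eq_of_mul_eq_one_left (node_mul_self hn cs (m + 1))]
    simp only [mul_assoc]

theorem signT_conj (x r : W) : signT hn cs (x * r * x⁻¹) = signT hn cs r := by
  rw [map_mul, map_mul, map_inv, mul_inv_cancel_comm]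

theorem signT_simple_ne_one_iff (i : Fin n) : signT hn cs (cs.simple i) ≠ 1 ↔ i = tIndex hn := by
  rw [signT_simple]
  by_cases hi : i = tIndex hn <;> simp [hi]

theorem signT_eq_one_of_mem_symSubgroup {x : W} (hx : x ∈ symSubgroup hn cs) :
    signT hn cs x = 1 := by
  induction hx using parabolicSubgroup_induction_left with
  | one => exact map_one _
  | simple_mul i hi x hx ih =>
    rw [map_mul, ih, mul_one]
    exact of_not_not (mt (signT_simple_ne_one_iff hn cs i).mp hi)

theorem lengthT_inv (w : W) : lengthT hn cs w⁻¹ = lengthT hn cs w := by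
  obtain ⟨ω, hω, rfl⟩ := cs.exists_isReduced w
  rw [← cs.wordProd_reverse, lengthT_wordProd hn cs hω, lengthT_wordProd hn cs hω.reverse,
    List.count_reverse]

theorem lengthT_simple_mul_of_lt {i : Fin n} {w : W}
    (h : cs.length w < cs.length (cs.simple i * w)) :
    lengthT hn cs (cs.simple i * w) = lengthT hn cs w + if i = tIndex hn then 1 else 0 := by
  have hlen := cs.length_simple_mul w i
  rw [lengthT_mul hn cs (by rw [cs.length_simple]; omega), lengthT_simple, add_comm]

theorem lengthT_le_lengthT_simple_mul (i : Fin n) (w : W) :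
    lengthT hn cs w ≤ lengthT hn cs (cs.simple i * w) + if i = tIndex hn then 1 else 0 := by
  rcases cs.length_simple_mul w i with h | h
  · rw [lengthT_simple_mul_of_lt hn cs (by omega), add_assoc]
    exact Nat.le_add_right _ _
  · have hlt := lengthT_simple_mul_of_lt hn cs (i := i) (w := cs.simple i * w)
      (by rw [cs.simple_mul_simple_cancel_left]; omega)
    rw [cs.simple_mul_simple_cancel_left] at hlt
    exact hlt.le

theorem lengthT_simple_mul {i : Fin n} (hi : i ≠ tIndex hn) (w : W) :
    lengthT hn cs (cs.simple i * w) = lengthT hn cs w := by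
  rcases cs.length_simple_mul w i with h | h
  · rw [lengthT_simple_mul_of_lt hn cs (by omega), if_neg hi, add_zero]
  · have hlt := lengthT_simple_mul_of_lt hn cs (i := i) (w := cs.simple i * w)
      (by rw [cs.simple_mul_simple_cancel_left]; omega)
    rwa [cs.simple_mul_simple_cancel_left, if_neg hi, add_zero, eq_comm] at hlt

theorem lengthT_mul_of_mem_symSubgroup {x : W} (hx : x ∈ symSubgroup hn cs) (w : W) :
    lengthT hn cs (x * w) = lengthT hn cs w := by
  induction hx using parabolicSubgroup_induction_left with
  | one => rw [one_mul]
  | simple_mul i hi x hx ih => rw [mul_assoc, lengthT_simple_mul hn cs hi, ih]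

theorem lengthT_jucysMurphy {m : ℕ} (hm : m < n) :
    lengthT hn cs (jucysMurphy (node hn cs) m) = 1 := by
  obtain ⟨x, hx, hconj⟩ := exists_jucysMurphy_eq_conj hn cs hm
  rw [hconj, mul_assoc, lengthT_mul_of_mem_symSubgroup hn cs (inv_mem hx), ← lengthT_inv,
    mul_inv_rev, lengthT_mul_of_mem_symSubgroup hn cs (inv_mem hx), lengthT_inv, lengthT_simple,
    if_pos rfl]

theorem lengthT_descProd_jucysMurphy {m : ℕ} (hm : m ≤ n) :
    lengthT hn cs (descProd (jucysMurphy (node hn cs)) m) = m := by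
  induction m with
  | zero =>
    simpa [descProd] using lengthT_wordProd hn cs (ω := []) (by simp [CoxeterSystem.IsReduced])
  | succ m ih =>
    rw [descProd, lengthT_mul hn cs (length_descProd_succ hn cs hm), lengthT_jucysMurphy hn cs hm,
      ih (by omega), add_comm]

open Classical in
/-- The conjugates of `t`, that is, the reflections on which `signT` is nontrivial. -/
noncomputable def tReflections : Finset W :=
  (Finset.range n).image (jucysMurphy (node hn cs))

variable {hn cs}

theorem mem_tReflections {r : W} :
    r ∈ tReflections hn cs ↔ ∃ m < n, jucysMurphy (node hn cs) m = r := by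
  simp [tReflections]

theorem simple_conj_mem_tReflections {r : W} (hr : r ∈ tReflections hn cs) (i : Fin n) :
    cs.simple i * r * cs.simple i ∈ tReflections hn cs := by
  rw [mem_tReflections] at hr ⊢
  obtain ⟨k, hk, rfl⟩ := hr
  rw [← nodeIndex_rev hn i]
  have hj := i.rev.isLt
  generalize (i.rev : ℕ) = j at hj ⊢
  change ∃ m < n, jucysMurphy (node hn cs) m =
    node hn cs j * jucysMurphy (node hn cs) k * node hn cs j
  have hbraid := node_isBraidB hn cs
  have of_commute (h : Commute (node hn cs j) (jucysMurphy (node hn cs) k)) : ∃ m < n,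
      jucysMurphy (node hn cs) m = node hn cs j * jucysMurphy (node hn cs) k * node hn cs j :=
    ⟨k, hk, by rw [h.eq, mul_assoc, node_mul_self, mul_one]⟩
  rcases Nat.lt_trichotomy j k with hlt | rfl | hgt
  · exact of_commute (hbraid.commute_of_gt hlt hk)
  · cases j with
    | zero => exact of_commute (Commute.refl _)
    | succ j =>
      refine ⟨j, by omega, ?_⟩
      rw [jucysMurphy, mul_assoc, mul_assoc, mul_assoc, node_mul_self, mul_one, ← mul_assoc,
        node_mul_self, one_mul]
  · rcases Nat.lt_or_ge (k + 1) j with hfar | hnear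
    · exact of_commute (hbraid.commute_of_lt hfar hj)
    · obtain rfl : j = k + 1 := by omega
      exact ⟨k + 1, hj, rfl⟩

theorem conj_mem_tReflections {r : W} (hr : r ∈ tReflections hn cs) (x : W) :
    x * r * x⁻¹ ∈ tReflections hn cs := by
  obtain ⟨ω, rfl⟩ := cs.wordProd_surjective x
  induction ω with
  | nil => simpa
  | cons i ω ih => simpa [cs.wordProd_cons, mul_assoc] using simple_conj_mem_tReflections ih i

theorem mem_tReflections_iff_signT {r : W} (hr : cs.IsReflection r) :
    r ∈ tReflections hn cs ↔ signT hn cs r ≠ 1 := by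
  constructor
  · intro h
    obtain ⟨m, hm, rfl⟩ := mem_tReflections.mp h
    obtain ⟨x, -, hconj⟩ := exists_jucysMurphy_eq_conj hn cs hm
    have hsign := signT_conj hn cs x⁻¹ (cs.simple (tIndex hn))
    rw [inv_inv, ← hconj] at hsign
    rw [hsign, signT_simple_ne_one_iff]
  · obtain ⟨x, i, rfl⟩ := hr
    rw [signT_conj, signT_simple_ne_one_iff]
    rintro rfl
    exact conj_mem_tReflections (mem_tReflections.mpr ⟨0, hn, rfl⟩) x

theorem invParity_eq_zero_of_mem_symSubgroup {x r : W} (hx : x ∈ symSubgroup hn cs)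
    (hr : signT hn cs r ≠ 1) : invParity cs x r = 0 := by
  rw [← invParity_ne_one_iff]
  exact fun h => hr (signT_eq_one_of_mem_symSubgroup hn cs
    (mem_parabolicSubgroup_of_invParity_eq_one hx h))

theorem lengthT_eq_card (w : W) : lengthT hn cs w =
    ((tReflections hn cs).filter fun r => invParity cs w r = 1).card := by
  classical
  obtain ⟨ω, hω, rfl⟩ := cs.exists_isReduced w
  rw [lengthT_wordProd hn cs hω, ← countP_rightInvSeq hn cs, List.countP_eq_length_filter,
    ← List.toFinset_card_of_nodup ((hω.nodup_rightInvSeq cs).filter _)]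
  congr 1
  ext r
  rw [List.mem_toFinset, List.mem_filter, Finset.mem_filter, invParity_eq_one_iff cs hω,
    decide_eq_true_iff, and_comm]
  exact and_congr_left fun hr =>
    (mem_tReflections_iff_signT (cs.isReflection_of_mem_rightInvSeq ω hr)).symm

theorem card_tReflections : (tReflections hn cs).card = n := by
  classical
  refine le_antisymm (Finset.card_image_le.trans (Finset.card_range n).le) ?_
  have hlength := lengthT_descProd_jucysMurphy hn cs le_rfl
  rw [lengthT_eq_card] at hlength
  exact hlength.ge.trans (Finset.card_filter_le _ _)

theorem lengthT_le (w : W) : lengthT hn cs w ≤ n := by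
  rw [lengthT_eq_card]
  exact (Finset.card_filter_le _ _).trans card_tReflections.le

theorem lengthT_eq_iff {w : W} :
    lengthT hn cs w = n ↔ ∀ r ∈ tReflections hn cs, invParity cs w r = 1 := by
  rw [lengthT_eq_card, ← Finset.card_filter_eq_iff, card_tReflections]

theorem mem_symSubgroup_of_lengthT_eq_zero {w : W} (hw : lengthT hn cs w = 0) :
    w ∈ symSubgroup hn cs := by
  obtain ⟨ω, hω, rfl⟩ := cs.exists_isReduced w
  rw [lengthT_wordProd hn cs hω, List.count_eq_zero] at hw
  exact wordProd_mem_parabolicSubgroup fun i hi => ne_of_mem_of_not_mem hi hw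

theorem mul_inv_mem_symSubgroup {w w' : W} (hw : lengthT hn cs w = n)
    (hw' : lengthT hn cs w' = n) : w * w'⁻¹ ∈ symSubgroup hn cs := by
  refine mem_symSubgroup_of_lengthT_eq_zero ?_
  rw [lengthT_eq_card, Finset.card_eq_zero, Finset.filter_eq_empty_iff]
  intro r hr
  rw [← lengthT_inv] at hw'
  rw [invParity_mul, lengthT_eq_iff.mp hw' r hr,
    lengthT_eq_iff.mp hw _ (conj_mem_tReflections hr w'⁻¹)]
  decide

theorem exists_length_lt_t_mul {w : W} (hw : lengthT hn cs w ≠ n) : ∃ x ∈ symSubgroup hn cs,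
    cs.length (x * w) < cs.length (cs.simple (tIndex hn) * (x * w)) := by
  by_contra! h
  refine hw ?_
  rw [← lengthT_inv, lengthT_eq_iff]
  intro r hr
  obtain ⟨m, hm, rfl⟩ := mem_tReflections.mp hr
  obtain ⟨x, hx, hconj⟩ := exists_jucysMurphy_eq_conj hn cs hm
  have hdescent : cs.length ((x * w)⁻¹ * cs.simple (tIndex hn)) < cs.length (x * w)⁻¹ := by
    have hne := cs.length_simple_mul_ne (x * w) (tIndex hn)
    rw [← cs.length_inv, cs.length_inv (x * w), mul_inv_rev, inv_inv, cs.inv_simple]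
    exact lt_of_le_of_ne (h x hx) hne
  have ht : signT hn cs (cs.simple (tIndex hn)) ≠ 1 :=
    (signT_simple_ne_one_iff hn cs _).mpr rfl
  rwa [length_mul_simple_lt_iff, mul_inv_rev, invParity_mul,
    invParity_eq_zero_of_mem_symSubgroup (inv_mem hx) ht, zero_add, inv_inv, ← hconj] at hdescent

end WeylGroupB

namespace Hecke

variable {B W Γ : Type*} [Group W] {M : CoxeterMatrix B} {cs : CoxeterSystem M W}
  [AddCommGroup Γ] [LinearOrder Γ] (L : WeightFunction cs Γ)

theorem coord_add (x y : Hecke cs L) (w : W) :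
    coord L (x + y) w = coord L x w + coord L y w :=
  map_add ((basis L).coord w) x y

theorem coord_sub (x y : Hecke cs L) (w : W) :
    coord L (x - y) w = coord L x w - coord L y w :=
  map_sub ((basis L).coord w) x y

theorem coord_smul (a : Ground Γ) (x : Hecke cs L) (w : W) :
    coord L (a • x) w = a * coord L x w :=
  map_smul ((basis L).coord w) a x

open Classical in
theorem coord_T (w y : W) : coord L (T L w) y = if w = y then 1 else 0 :=
  (basis L).repr_self_apply w y

theorem T_simple_mul_of_lt {i : B} {w : W} (h : cs.length w < cs.length (cs.simple i * w)) :
    T L (cs.simple i) * T L w = T L (cs.simple i * w) := by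
  rw [T_simple_mul, lmul_up L h]

theorem T_simple_mul_of_gt {i : B} {w : W} (h : cs.length (cs.simple i * w) < cs.length w) :
    T L (cs.simple i) * T L w = T L (cs.simple i * w) + xi L i • T L w := by
  rw [T_simple_mul, lmul_down L h]

theorem T_simple_mul_T (i : B) (w : W) : T L (cs.simple i) * T L w =
    T L (cs.simple i * w) +
      (if cs.length (cs.simple i * w) < cs.length w then xi L i else 0) • T L w := by
  split_ifs with h
  · exact T_simple_mul_of_gt L h
  · have hne := cs.length_simple_mul_ne w i
    rw [T_simple_mul_of_lt L (by omega), zero_smul, add_zero]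

theorem coord_T_simple_mul (i : B) (x : Hecke cs L) (w : W) :
    coord L (T L (cs.simple i) * x) w = coord L x (cs.simple i * w) +
      (if cs.length (cs.simple i * w) < cs.length w then xi L i else 0) * coord L x w := by
  rw [T_simple_mul]
  suffices h : (basis L).coord w ∘ₗ lmul L i = (basis L).coord (cs.simple i * w) +
      (if cs.length (cs.simple i * w) < cs.length w then xi L i else 0) • (basis L).coord w from
    LinearMap.congr_fun h x
  refine (basis L).ext fun y => ?_
  change coord L (lmul L i (T L y)) w = coord L (T L y) (cs.simple i * w) +
    (if cs.length (cs.simple i * w) < cs.length w then xi L i else 0) * coord L (T L y) w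
  have hy : cs.simple i * y = w ↔ y = cs.simple i * w := by
    constructor <;> rintro rfl <;> rw [cs.simple_mul_simple_cancel_left]
  rw [← T_simple_mul, T_simple_mul_T, coord_add, coord_smul, coord_T, coord_T, coord_T]
  classical
  rw [if_congr hy rfl rfl]
  by_cases hyw : y = w
  · rw [hyw]
  · rw [if_neg hyw, mul_zero, mul_zero]

theorem T_wordProd {ω : List B} (h : cs.IsReduced ω) :
    T L (cs.wordProd ω) = (ω.map fun i => T L (cs.simple i)).prod := by
  induction ω with
  | nil => rw [cs.wordProd_nil, ← one_def]; rfl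
  | cons i ω ih =>
    have hω : cs.IsReduced ω := h.drop 1
    have hlen := h.eq
    rw [cs.wordProd_cons, List.length_cons, ← hω.eq] at hlen
    rw [List.map_cons, List.prod_cons, ← ih hω, cs.wordProd_cons, T_simple_mul_of_lt L (by omega)]

theorem prod_T_eq_of_wordProd_eq {ω ω' : List B} (h : cs.IsReduced ω)
    (hlen : ω.length = ω'.length) (hprod : cs.wordProd ω = cs.wordProd ω') :
    (ω.map fun i => T L (cs.simple i)).prod = (ω'.map fun i => T L (cs.simple i)).prod := by
  have h' : cs.IsReduced ω' := by rw [CoxeterSystem.IsReduced, ← hprod, h.eq, hlen]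
  rw [← T_wordProd L h, ← T_wordProd L h', hprod]

theorem commute_T_simple {i j : B} (h : Commute (cs.simple i) (cs.simple j)) :
    Commute (T L (cs.simple i)) (T L (cs.simple j)) := by
  rcases cs.length_simple_mul (cs.simple j) i with hup | hdown
  · have hlen : cs.length (cs.simple i * cs.simple j) =
        cs.length (cs.simple i) + cs.length (cs.simple j) := by
      rw [hup, cs.length_simple, cs.length_simple]
    have hlen' : cs.length (cs.simple j * cs.simple i) =
        cs.length (cs.simple j) + cs.length (cs.simple i) := by rw [← h.eq, hlen, add_comm]
    rw [commute_iff_eq, T_mul_T L hlen, T_mul_T L hlen', h.eq]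
  · have hone : cs.simple i * cs.simple j = 1 := by
      rw [cs.length_simple] at hdown
      exact cs.length_eq_zero_iff.mp (by omega)
    rw [eq_inv_of_mul_eq_one_left hone, cs.inv_simple]

theorem mul_mem_of_mem_parabolic {I : Set B} {P : Submodule (Ground Γ) (Hecke cs L)}
    (hP : ∀ i ∈ I, ∀ h ∈ P, T L (cs.simple i) * h ∈ P) {x h : Hecke cs L}
    (hx : x ∈ parabolic L I) (hh : h ∈ P) : x * h ∈ P := by
  induction hx using Algebra.adjoin_induction generalizing h with
  | mem y hy => obtain ⟨i, hi, rfl⟩ := hy; exact hP i hi h hh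
  | algebraMap a => rw [← Algebra.smul_def]; exact P.smul_mem a hh
  | add y z _ _ hy hz => rw [add_mul]; exact add_mem (hy hh) (hz hh)
  | mul y z _ _ hy hz => rw [mul_assoc]; exact hy (hz hh)

theorem parabolic_univ : parabolic L Set.univ = ⊤ := by
  rw [← Algebra.toSubmodule_eq_top, ← top_le_iff, ← (basis L).span_eq, Submodule.span_le]
  rintro _ ⟨w, rfl⟩
  obtain ⟨ω, hω, rfl⟩ := cs.exists_isReduced w
  change T L (cs.wordProd ω) ∈ parabolic L Set.univ
  rw [T_wordProd L hω]
  refine list_prod_mem fun x hx => ?_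
  obtain ⟨i, -, rfl⟩ := List.mem_map.mp hx
  exact Algebra.subset_adjoin ⟨i, Set.mem_univ i, rfl⟩

section Support

variable {L} {D : AddSubgroup (Ground Γ)}

theorem coord_T_simple_mul_mem_iff {i : B} (hD : ∀ a ∈ D, xi L i * a ∈ D) {h : Hecke cs L} {w : W}
    (hw : coord L h w ∈ D) :
    coord L (T L (cs.simple i) * h) w ∈ D ↔ coord L h (cs.simple i * w) ∈ D := by
  rw [coord_T_simple_mul]
  refine add_mem_cancel_right ?_
  split_ifs
  · exact hD _ hw
  · rw [zero_mul]
    exact zero_mem D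

theorem coord_mem_of_coord_mul_mem {I : Set B} {S : Set (Hecke cs L)}
    (hS : ∀ i ∈ I, ∀ h ∈ S, T L (cs.simple i) * h ∈ S) (hD : ∀ i ∈ I, ∀ a ∈ D, xi L i * a ∈ D)
    {x w : W} (hx : x ∈ parabolicSubgroup cs I) (hw : ∀ h ∈ S, coord L h (x * w) ∈ D)
    {h : Hecke cs L} (hh : h ∈ S) : coord L h w ∈ D := by
  induction hx using parabolicSubgroup_induction_right generalizing w h with
  | one => simpa only [one_mul] using hw h hh
  | mul_simple x _ i hi ih =>
    have hsw {h : Hecke cs L} (hh : h ∈ S) : coord L h (cs.simple i * w) ∈ D :=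
      ih (fun h hh => by simpa only [mul_assoc] using hw h hh) hh
    have hiff := coord_T_simple_mul_mem_iff (hD i hi) (hsw hh)
    rw [cs.simple_mul_simple_cancel_left] at hiff
    exact hiff.mp (hsw (hS i hi h hh))

end Support

theorem groundBar_xi (i : B) : groundBar (xi L i) = -xi L i := by
  rw [xi, map_sub, groundBar_vpow, groundBar_vpow, neg_neg, neg_sub]

/-- The bar involution as a semilinear map. -/
noncomputable def barMap : Hecke cs L →ₛₗ[groundBar (Γ := Γ)] Hecke cs L where
  toFun := bar L
  map_add' x y := by
    rw [bar, map_add, Finsupp.sum_add_index']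
    · rfl
    · simp
    · simp [add_smul]
  map_smul' a x := by
    rw [bar, map_smul, Finsupp.sum_smul_index (by simp), bar, Finsupp.smul_sum]
    simp only [map_mul, smul_smul]

theorem barMap_T (w : W) : barMap L (T L w) = Ring.inverse (T L w⁻¹) := by
  change bar L _ = _
  rw [bar, T, Module.Basis.repr_self, Finsupp.sum_single_index (by simp), map_one, one_smul]

theorem barMap_one : barMap L 1 = 1 := by
  rw [one_def, barMap_T, inv_one, ← one_def, Ring.inverse_one]

theorem inverse_T_simple (i : B) :
    Ring.inverse (T L (cs.simple i)) = T L (cs.simple i) - xi L i • 1 := by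
  have hsq := T_simple_sq L i
  rw [pow_two] at hsq
  have hmul : T L (cs.simple i) * (T L (cs.simple i) - xi L i • 1) = 1 := by
    rw [mul_sub, hsq, mul_smul_comm, mul_one, xi, add_sub_cancel_right]
  rw [← Ring.inverse_mul_cancel_left _ (T L (cs.simple i) - xi L i • 1) (isUnit_T_simple L i),
    hmul, mul_one]

theorem barMap_T_simple_mul_of_lt {i : B} {w : W}
    (h : cs.length w < cs.length (cs.simple i * w)) : barMap L (T L (cs.simple i * w)) =
      T L (cs.simple i) * barMap L (T L w) - xi L i • barMap L (T L w) := by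
  have hlen : cs.length (w⁻¹ * cs.simple i) = cs.length w⁻¹ + cs.length (cs.simple i) := by
    have hlen := cs.length_simple_mul w i
    rw [← cs.length_inv, cs.length_inv w, mul_inv_rev, inv_inv, cs.inv_simple, cs.length_simple]
    omega
  rw [barMap_T, barMap_T, mul_inv_rev, cs.inv_simple, ← T_mul_T L hlen,
    Ring.inverse_mul (Or.inl (isUnit_T L _)), inverse_T_simple, sub_mul, smul_mul_assoc, one_mul]

theorem barMap_T_simple_mul (i : B) (x : Hecke cs L) : barMap L (T L (cs.simple i) * x) =
    T L (cs.simple i) * barMap L x - xi L i • barMap L x := by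
  rw [T_simple_mul, T_simple_mul]
  suffices h : (barMap L).comp (lmul L i) = (lmul L i - xi L i • 1 : Module.End _ _).comp (barMap L)
    from LinearMap.congr_fun h x
  refine (basis L).ext fun w => ?_
  change barMap L (lmul L i (T L w)) =
    lmul L i (barMap L (T L w)) - xi L i • barMap L (T L w)
  rw [← T_simple_mul, ← T_simple_mul]
  rcases lt_or_gt_of_ne (cs.length_simple_mul_ne w i) with h | h
  · have hup := barMap_T_simple_mul_of_lt L (i := i) (w := cs.simple i * w)
      (by rwa [cs.simple_mul_simple_cancel_left])
    rw [cs.simple_mul_simple_cancel_left] at hup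
    have hsq := T_simple_sq L i
    rw [pow_two] at hsq
    rw [T_simple_mul_of_gt L h, map_add, map_smulₛₗ, groundBar_xi, hup, mul_sub, ← mul_assoc, hsq,
      add_mul, one_mul, mul_smul_comm, smul_mul_assoc, ← xi, neg_smul]
    module
  · rw [T_simple_mul_of_lt L h, barMap_T_simple_mul_of_lt L h]

theorem barMap_involutive : Function.Involutive (barMap L) := by
  have : RingHomInvPair (groundBar (Γ := Γ)) groundBar :=
    ⟨RingHom.ext groundBar_involutive, RingHom.ext groundBar_involutive⟩
  suffices h : (barMap L).comp (barMap L) = LinearMap.id from LinearMap.congr_fun h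
  refine (basis L).ext fun w => ?_
  change barMap L (barMap L (T L w)) = T L w
  obtain ⟨ω, hω, rfl⟩ := cs.exists_isReduced w
  rw [T_wordProd L hω]
  clear hω
  induction ω with
  | nil => rw [List.map_nil, List.prod_nil, barMap_one, barMap_one]
  | cons i ω ih =>
    rw [List.map_cons, List.prod_cons, barMap_T_simple_mul, map_sub, map_smulₛₗ,
      barMap_T_simple_mul, ih, groundBar_xi, neg_smul, sub_neg_eq_add, sub_add_cancel]

theorem coord_barMap_T_sub {w y : W} (h : cs.length w ≤ cs.length y) :
    coord L (barMap L (T L w) - T L w) y = 0 := by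
  obtain ⟨ω, hω, rfl⟩ := cs.exists_isReduced w
  induction ω generalizing y with
  | nil => rw [cs.wordProd_nil, ← one_def, barMap_one, sub_self]; exact map_zero ((basis L).coord y)
  | cons i ω ih =>
    have hω' : cs.IsReduced ω := hω.drop 1
    have hlen := hω.eq
    rw [cs.wordProd_cons, List.length_cons, ← hω'.eq] at hlen
    rw [cs.wordProd_cons] at h ⊢
    have hy := cs.length_simple_mul y i
    have hne : cs.wordProd ω ≠ y := by rintro rfl; omega
    set d := barMap L (T L (cs.wordProd ω)) - T L (cs.wordProd ω) with hd
    have hbar : barMap L (T L (cs.simple i * cs.wordProd ω)) -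
        T L (cs.simple i * cs.wordProd ω) =
        T L (cs.simple i) * d - xi L i • d - xi L i • T L (cs.wordProd ω) := by
      rw [← T_simple_mul_of_lt L (by omega), barMap_T_simple_mul, hd, mul_sub, smul_sub]
      abel
    rw [hbar, coord_sub, coord_sub, coord_T_simple_mul, coord_smul, coord_smul, coord_T,
      if_neg hne, ih hω' (by omega), ih hω' (by omega)]
    simp only [mul_zero, add_zero, sub_zero]

theorem isUnitriangularInvolution_barMap :
    IsUnitriangularInvolution (basis L) (barMap L) cs.length where
  involutive := barMap_involutive L
  repr_sub_self _ _ h := coord_barMap_T_sub L h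

theorem IsKazhdanLusztig.unique [IsOrderedAddMonoid Γ] {w : W} {c c' : Hecke cs L}
    (hc : IsKazhdanLusztig L w c) (hc' : IsKazhdanLusztig L w c') : c = c' :=
  (isUnitriangularInvolution_barMap L).isCanonical_unique hc hc'

end Hecke

section MurphyProduct

variable {A R : Type*} [CommRing A] [Ring R] [Algebra A R]

/-- The product of the `L_i + c` for `i < m`, with `L_i` the Jucys–Murphy products of `g`. -/
def murphyProd (g : ℕ → R) (c : A) : ℕ → R :=
  descProd fun i => jucysMurphy g i + algebraMap A R c

theorem commute_mul_of_sq_eq {g a : R} {x c : A} (hg : g * g = 1 + x • g)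
    (ha : Commute a (g * a * g)) :
    Commute g ((g * a * g + algebraMap A R c) * (a + algebraMap A R c)) := by
  have hprod : Commute g (g * a * g * a) := by
    have ha' : a * (g * (a * g)) = g * (a * (g * a)) := by simpa only [mul_assoc] using ha.eq
    simp only [Commute, SemiconjBy, mul_assoc, ha']
  have hsum : Commute g (g * a * g + a) := by
    have hleft : g * (g * a * g) = a * g + x • (g * a * g) := by
      rw [← mul_assoc, ← mul_assoc, hg, add_mul, add_mul, one_mul, smul_mul_assoc, smul_mul_assoc]
    have hright : g * a * g * g = g * a + x • (g * a * g) := by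
      rw [mul_assoc (g * a), hg, mul_add, mul_one, mul_smul_comm]
    rw [Commute, SemiconjBy, mul_add, add_mul, hleft, hright]
    abel
  have hexpand : (g * a * g + algebraMap A R c) * (a + algebraMap A R c) =
      g * a * g * a + c • (g * a * g + a) + algebraMap A R (c * c) := by
    rw [mul_add, add_mul, add_mul, ← Algebra.commutes, ← Algebra.smul_def, ← Algebra.smul_def,
      ← map_mul, smul_add]
    abel
  rw [hexpand]
  exact (hprod.add_right (hsum.smul_right c)).add_right (Algebra.commute_algebraMap_right _ _)

namespace IsBraidB

variable {n : ℕ} {g : ℕ → R} (h : IsBraidB n g) {c : A} {m j : ℕ}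
include h

theorem commute_murphyProd_of_lt (hmj : m < j) (hj : j < n) :
    Commute (g j) (murphyProd g c m) := by
  induction m with
  | zero => exact Commute.one_right _
  | succ m ih =>
    exact ((h.commute_of_lt hmj hj).add_right (Algebra.commute_algebraMap_right _ _)).mul_right
      (ih (by omega))

theorem commute_murphyProd {x : A} (hsq : g j * g j = 1 + x • g j) (h0 : 0 < j) (hjm : j < m)
    (hm : m ≤ n) : Commute (g j) (murphyProd g c m) := by
  induction m with
  | zero => omega
  | succ m ih =>
    rcases Nat.lt_succ_iff_lt_or_eq.mp hjm with hlt | rfl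
    · exact ((h.commute_of_gt hlt hm).add_right (Algebra.commute_algebraMap_right _ _)).mul_right
        (ih hlt (by omega))
    · obtain ⟨j, rfl⟩ := Nat.exists_eq_add_of_le' h0
      rw [murphyProd, descProd, descProd, ← mul_assoc]
      have hlt := Nat.lt_succ_self j
      exact (commute_mul_of_sq_eq hsq (h.jucysMurphy_commute_of_lt hlt hm)).mul_right
        (h.commute_murphyProd_of_lt hlt hm)

theorem sub_mul_murphyProd {q : A}
    (hq : (g 0 - algebraMap A R q) * (g 0 + algebraMap A R c) = 0) (h0 : 0 < m) (hm : m ≤ n) :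
    (g 0 - algebraMap A R q) * murphyProd g c m = 0 := by
  induction m, h0 using Nat.le_induction with
  | base => simpa [murphyProd, descProd, jucysMurphy] using hq
  | succ m h1 ih =>
    have hcomm : Commute (g 0 - algebraMap A R q) (jucysMurphy g m + algebraMap A R c) :=
      ((h.commute_of_gt h1 hm).sub_left (Algebra.commute_algebraMap_left _ _)).add_right
        (Algebra.commute_algebraMap_right _ _)
    rw [murphyProd, descProd, ← mul_assoc, hcomm.eq, mul_assoc, ← murphyProd, ih (by omega),
      mul_zero]

end IsBraidB

end MurphyProduct

open Hecke

section HeckeB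

variable {n : ℕ} (hn : 1 ≤ n) {W : Type*} [Group W] (cs : CoxeterSystem (CoxeterMatrix.B n) W)

/-- The generators `T_t = nodeT 0` and `T_{s_j} = nodeT j`, for `0 < j < n`. -/
noncomputable def nodeT (j : ℕ) : HeckeB hn cs := T (weightB hn cs) (node hn cs j)

theorem nodeT_zero : nodeT hn cs 0 = Tt hn cs := rfl

theorem nodeT_mul_self (j : ℕ) : nodeT hn cs j * nodeT hn cs j =
    1 + xi (weightB hn cs) (nodeIndex hn j) • nodeT hn cs j := by
  rw [← pow_two]
  exact T_simple_sq _ _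

theorem groundBar_V_mul_V : groundBar V * V = 1 := by
  rw [V, groundBar_vpow, vpow_neg_mul_vpow]

theorem xi_tIndex : xi (weightB hn cs) (tIndex hn) = V - groundBar V := by
  have hweight : (weightB hn cs).toFun (cs.simple (tIndex hn)) = toLex (1, 0) := by
    simp [weightB, lengthT_simple]
  rw [xi, hweight, V, groundBar_vpow]

theorem Tt_sub_mul_add :
    (Tt hn cs - algebraMap _ _ V) * (Tt hn cs + algebraMap _ _ (groundBar V)) = 0 := by
  have hsq := nodeT_mul_self hn cs 0
  rw [nodeT_zero] at hsq
  change Tt hn cs * Tt hn cs = 1 + xi (weightB hn cs) (tIndex hn) • Tt hn cs at hsq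
  rw [sub_mul, mul_add, mul_add, hsq, xi_tIndex, ← map_mul, mul_comm V, groundBar_V_mul_V, map_one,
    ← Algebra.commutes, ← Algebra.smul_def, ← Algebra.smul_def, sub_smul]
  abel

theorem T_jucysMurphy {m : ℕ} (hm : m < n) :
    T (weightB hn cs) (jucysMurphy (node hn cs) m) = jucysMurphy (nodeT hn cs) m := by
  induction m with
  | zero => rfl
  | succ m ih =>
    have hnode : cs.length (node hn cs (m + 1)) = 1 := cs.length_simple _
    have hlen := length_jucysMurphy hn cs hm
    have hlen' := length_jucysMurphy hn cs (j := m) (by omega)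
    have hle := cs.length_mul_le (node hn cs (m + 1)) (jucysMurphy (node hn cs) m)
    have hge := cs.length_mul_le (node hn cs (m + 1) * jucysMurphy (node hn cs) m)
      (node hn cs (m + 1))
    rw [jucysMurphy] at hlen
    rw [jucysMurphy, jucysMurphy, ← ih (by omega), nodeT, T_mul_T _ (by omega),
      T_mul_T _ (by omega)]

theorem nodeT_isBraidB : IsBraidB n (nodeT hn cs) where
  four h := by
    have hbraid := (node_isBraidB hn cs).four h
    have hlen := length_jucysMurphy_mul hn cs h
      (node_mem_parabolicSubgroup_of_lt hn cs hn (by norm_num))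
    rw [length_jucysMurphy hn cs h] at hlen
    have hword := prod_T_eq_of_wordProd_eq (weightB hn cs)
      (ω := [nodeIndex hn 1, nodeIndex hn 0, nodeIndex hn 1, nodeIndex hn 0])
      (ω' := [nodeIndex hn 0, nodeIndex hn 1, nodeIndex hn 0, nodeIndex hn 1])
      (by simpa [CoxeterSystem.IsReduced, cs.wordProd_cons, mul_assoc, jucysMurphy, node]
        using hlen) rfl (by simpa [cs.wordProd_cons, mul_assoc, node] using hbraid.symm)
    simpa [nodeT, node, mul_assoc] using hword.symm
  three i h1 h2 := by
    have hbraid := (node_isBraidB hn cs).three i h1 h2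
    have hlen := length_node_mul_node_mul_node hn cs h2
    have hword := prod_T_eq_of_wordProd_eq (weightB hn cs)
      (ω := [nodeIndex hn i, nodeIndex hn (i + 1), nodeIndex hn i])
      (ω' := [nodeIndex hn (i + 1), nodeIndex hn i, nodeIndex hn (i + 1)])
      (by simpa [CoxeterSystem.IsReduced, cs.wordProd_cons, mul_assoc, node] using hlen)
      rfl (by simpa [cs.wordProd_cons, mul_assoc, node] using hbraid)
    simpa [nodeT, node, mul_assoc] using hword
  comm i j h1 h2 := commute_T_simple _ ((node_isBraidB hn cs).comm i j h1 h2)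

/-- The `h` with coefficient `0` on every `T_w` with `ℓ_t(w) ≥ k`. -/
def tFiltration (k : ℕ) : Submodule (Ground (ℤ ×ₗ ℤ)) (HeckeB hn cs) where
  carrier := {h | ∀ w, k ≤ lengthT hn cs w → coord (weightB hn cs) h w = 0}
  zero_mem' w _ := map_zero ((basis (weightB hn cs)).coord w)
  add_mem' hx hy w hw := by rw [coord_add, hx w hw, hy w hw, add_zero]
  smul_mem' a x hx w hw := by rw [coord_smul, hx w hw, mul_zero]

variable {hn cs} {k : ℕ}

theorem tFiltration_mono {k' : ℕ} (h : k ≤ k') : tFiltration hn cs k ≤ tFiltration hn cs k' :=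
  fun _ hx w hw => hx w (h.trans hw)

theorem T_mem_tFiltration {w : W} (hw : lengthT hn cs w < k) :
    T (weightB hn cs) w ∈ tFiltration hn cs k := fun y hy => by
  have hne : w ≠ y := by rintro rfl; omega
  rw [coord_T, if_neg hne]

theorem T_simple_mul_mem_tFiltration (i : Fin n) {x : HeckeB hn cs}
    (hx : x ∈ tFiltration hn cs k) : T (weightB hn cs) (cs.simple i) * x ∈
      tFiltration hn cs (k + if i = tIndex hn then 1 else 0) := fun w hw => by
  have hle := lengthT_le_lengthT_simple_mul hn cs i w
  rw [coord_T_simple_mul, hx _ (by omega), hx w (by omega), mul_zero, add_zero]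

theorem T_simple_mul_mem_tFiltration_of_ne {i : Fin n} (hi : i ≠ tIndex hn) {x : HeckeB hn cs}
    (hx : x ∈ tFiltration hn cs k) :
    T (weightB hn cs) (cs.simple i) * x ∈ tFiltration hn cs k := by
  simpa only [if_neg hi, add_zero] using T_simple_mul_mem_tFiltration i hx

theorem barMap_T_mem_tFiltration {w : W} (hw : lengthT hn cs w < k) :
    barMap (weightB hn cs) (T (weightB hn cs) w) ∈ tFiltration hn cs k := by
  obtain ⟨ω, hω, rfl⟩ := cs.exists_isReduced w
  induction ω generalizing k with
  | nil => simpa only [cs.wordProd_nil, ← one_def, barMap_one] using T_mem_tFiltration hw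
  | cons i ω ih =>
    have hω' : cs.IsReduced ω := hω.drop 1
    have hlen := hω.eq
    rw [cs.wordProd_cons, List.length_cons, ← hω'.eq] at hlen
    have hlt : cs.length (cs.wordProd ω) < cs.length (cs.simple i * cs.wordProd ω) := by omega
    have hlengthT := lengthT_simple_mul_of_lt hn cs hlt
    rw [cs.wordProd_cons] at hw ⊢
    rw [← T_simple_mul_of_lt _ hlt, barMap_T_simple_mul]
    have hmem := ih (k := k - if i = tIndex hn then 1 else 0) hω' (by omega)
    have hmul := T_simple_mul_mem_tFiltration i hmem
    rw [Nat.sub_add_cancel (by omega)] at hmul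
    exact sub_mem hmul (Submodule.smul_mem _ _ (tFiltration_mono (Nat.sub_le _ _) hmem))

theorem barMap_mem_tFiltration {x : HeckeB hn cs} (hx : x ∈ tFiltration hn cs k) :
    barMap (weightB hn cs) x ∈ tFiltration hn cs k := by
  have hle : Submodule.span _ (basis (weightB hn cs) '' {w | lengthT hn cs w < k}) ≤
      (tFiltration hn cs k).comap (barMap (weightB hn cs)) := by
    rw [Submodule.span_le]
    rintro _ ⟨w, hw, rfl⟩
    exact barMap_T_mem_tFiltration hw
  exact hle ((basis _).mem_span_image.mpr fun w hw => lt_of_not_ge fun hk =>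
    Finsupp.mem_support_iff.mp hw (hx w hk))

theorem jucysMurphy_mul_mem_tFiltration {m : ℕ} (hm : m < n) {x : HeckeB hn cs}
    (hx : x ∈ tFiltration hn cs k) :
    jucysMurphy (nodeT hn cs) m * x ∈ tFiltration hn cs (k + 1) := by
  induction m generalizing x with
  | zero =>
    have hmem := T_simple_mul_mem_tFiltration (tIndex hn) hx
    rwa [if_pos rfl] at hmem
  | succ m ih =>
    have hne := nodeIndex_ne_tIndex hn (Nat.succ_pos m) hm
    rw [jucysMurphy, mul_assoc, mul_assoc]
    exact T_simple_mul_mem_tFiltration_of_ne hne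
      (ih (by omega) (T_simple_mul_mem_tFiltration_of_ne hne hx))

theorem murphyProd_sub_T_mem_tFiltration (c : Ground (ℤ ×ₗ ℤ)) {m : ℕ} (hm : m ≤ n) :
    murphyProd (nodeT hn cs) c m - T (weightB hn cs) (descProd (jucysMurphy (node hn cs)) m) ∈
      tFiltration hn cs m := by
  induction m with
  | zero => simp only [murphyProd, descProd, ← one_def, sub_self, zero_mem]
  | succ m ih =>
    set P := murphyProd (nodeT hn cs) c m
    set D := T (weightB hn cs) (descProd (jucysMurphy (node hn cs)) m) with hD
    have hlower : P - D ∈ tFiltration hn cs m := ih (by omega)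
    have hP : P ∈ tFiltration hn cs (m + 1) := by
      rw [← sub_add_cancel P D]
      exact add_mem (tFiltration_mono m.le_succ hlower) (T_mem_tFiltration
        ((lengthT_descProd_jucysMurphy hn cs (m := m) (by omega)).trans_lt m.lt_succ_self))
    have hsplit : murphyProd (nodeT hn cs) c (m + 1) -
        T (weightB hn cs) (descProd (jucysMurphy (node hn cs)) (m + 1)) =
        jucysMurphy (nodeT hn cs) m * (P - D) + c • P := by
      rw [murphyProd, descProd, descProd, ← T_mul_T _ (length_descProd_succ hn cs hm),
        T_jucysMurphy hn cs hm, ← hD, ← murphyProd, add_mul, ← Algebra.smul_def, mul_sub]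
      abel
    rw [hsplit]
    exact add_mem (jucysMurphy_mul_mem_tFiltration hm hlower) (Submodule.smul_mem _ _ hP)

end HeckeB

section SymAnnihilator

variable {n : ℕ} (hn : 1 ≤ n) {W : Type*} [Group W] (cs : CoxeterSystem (CoxeterMatrix.B n) W)

/-- The annihilator of `(T_t - V) * H(𝔖_n)` in `H_n`. -/
def symAnnihilator : Submodule (Ground (ℤ ×ₗ ℤ)) (HeckeB hn cs) where
  carrier := {h | ∀ x ∈ heckeSym hn cs, (Tt hn cs - algebraMap _ _ V) * x * h = 0}
  zero_mem' x _ := mul_zero _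
  add_mem' ha hb x hx := by rw [mul_add, ha x hx, hb x hx, add_zero]
  smul_mem' a h hh x hx := by rw [mul_smul_comm, hh x hx, smul_zero]

variable {hn cs} {h : HeckeB hn cs}

theorem Tt_mul_of_mem_symAnnihilator (hh : h ∈ symAnnihilator hn cs) :
    Tt hn cs * h = V • h := by
  have hone := hh 1 (one_mem _)
  rwa [mul_one, sub_mul, ← Algebra.smul_def, sub_eq_zero] at hone

theorem T_simple_mul_mem_symAnnihilator (i : Fin n) (hh : h ∈ symAnnihilator hn cs) :
    T (weightB hn cs) (cs.simple i) * h ∈ symAnnihilator hn cs := by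
  by_cases hi : i = tIndex hn
  · rw [hi, ← Tt, Tt_mul_of_mem_symAnnihilator hh]
    exact Submodule.smul_mem _ _ hh
  · intro x hx
    rw [← mul_assoc, mul_assoc _ x]
    exact hh _ (mul_mem hx (Algebra.subset_adjoin ⟨i, hi, rfl⟩))

theorem mul_mem_symAnnihilator (x : HeckeB hn cs) (hh : h ∈ symAnnihilator hn cs) :
    x * h ∈ symAnnihilator hn cs :=
  mul_mem_of_mem_parabolic (I := Set.univ) _
    (fun i _ _ => T_simple_mul_mem_symAnnihilator i) (parabolic_univ (weightB hn cs) ▸ trivial) hh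

theorem le_symAnnihilator {P : Submodule (Ground (ℤ ×ₗ ℤ)) (HeckeB hn cs)}
    (hs : ∀ i ≠ tIndex hn, ∀ h ∈ P, T (weightB hn cs) (cs.simple i) * h ∈ P)
    (ht : ∀ h ∈ P, Tt hn cs * h = V • h) : P ≤ symAnnihilator hn cs := fun h hh x hx => by
  rw [mul_assoc, sub_mul, ← Algebra.smul_def, ht _ (mul_mem_of_mem_parabolic _ hs hx hh), sub_self]

theorem barMap_mem_symAnnihilator (hh : h ∈ symAnnihilator hn cs) :
    barMap (weightB hn cs) h ∈ symAnnihilator hn cs := by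
  have hinv := barMap_involutive (weightB hn cs)
  suffices (symAnnihilator hn cs).comap (barMap (weightB hn cs)) ≤ symAnnihilator hn cs from
    this (by rwa [Submodule.mem_comap, hinv])
  refine le_symAnnihilator (fun i _ y hy => ?_) fun y hy => hinv.injective ?_
  · rw [Submodule.mem_comap, barMap_T_simple_mul]
    exact sub_mem (T_simple_mul_mem_symAnnihilator i hy) (Submodule.smul_mem _ _ hy)
  · rw [Tt, barMap_T_simple_mul, ← Tt, Tt_mul_of_mem_symAnnihilator hy, map_smulₛₗ, xi_tIndex,
      ← sub_smul, sub_sub_cancel]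

theorem murphyProd_mem_symAnnihilator :
    murphyProd (nodeT hn cs) (groundBar V) n ∈ symAnnihilator hn cs := by
  have hbraid := nodeT_isBraidB hn cs
  have hcomm : heckeSym hn cs ≤
      Subalgebra.centralizer _ {murphyProd (nodeT hn cs) (groundBar V) n} := by
    refine Algebra.adjoin_le ?_
    rintro _ ⟨i, hi, rfl⟩
    have hpos : 0 < (i.rev : ℕ) := by
      rw [Nat.pos_iff_ne_zero]
      exact fun h0 => hi (by rw [← nodeIndex_rev hn i, h0]; rfl)
    have hj := hbraid.commute_murphyProd (c := groundBar V) (nodeT_mul_self hn cs _) hpos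
      i.rev.isLt le_rfl
    rw [nodeT, node, nodeIndex_rev] at hj
    rw [SetLike.mem_coe, Subalgebra.mem_centralizer_iff]
    rintro _ rfl
    exact hj.symm.eq
  have hzero := hbraid.sub_mul_murphyProd (Tt_sub_mul_add hn cs) hn le_rfl
  intro x hx
  rw [mul_assoc, ← (Subalgebra.mem_centralizer_iff _).mp (hcomm hx) _ rfl, ← mul_assoc]
  exact (congrArg (· * x) hzero).trans (zero_mul x)

theorem coord_eq_groundBar_V_mul (hh : h ∈ symAnnihilator hn cs) {w : W}
    (hw : cs.length w < cs.length (cs.simple (tIndex hn) * w)) : coord (weightB hn cs) h w =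
      groundBar V * coord (weightB hn cs) h (cs.simple (tIndex hn) * w) := by
  have hcoord := coord_T_simple_mul (weightB hn cs) (tIndex hn) h (cs.simple (tIndex hn) * w)
  rw [cs.simple_mul_simple_cancel_left, if_pos hw, ← Tt, Tt_mul_of_mem_symAnnihilator hh,
    coord_smul, xi_tIndex, ← sub_eq_iff_eq_add, ← sub_mul, sub_sub_cancel] at hcoord
  exact hcoord.symm

/-- Moving within a coset of `𝔖_n` does not change `ℓ_t`, and each descent by `t` costs a factor
`V⁻¹`. -/
theorem coord_mem_of_mem_symAnnihilator {D : ℕ → AddSubgroup (Ground (ℤ ×ₗ ℤ))}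
    (hxi : ∀ l, ∀ i ≠ tIndex hn, ∀ a ∈ D l, xi (weightB hn cs) i * a ∈ D l)
    (hV : ∀ l, ∀ a ∈ D (l + 1), groundBar V * a ∈ D l) (hh : h ∈ symAnnihilator hn cs)
    (htop : ∀ w, lengthT hn cs w = n → coord (weightB hn cs) h w ∈ D n) (w : W) :
    coord (weightB hn cs) h w ∈ D (lengthT hn cs w) := by
  set S : Set (HeckeB hn cs) := {h | h ∈ symAnnihilator hn cs ∧
    ∀ w, lengthT hn cs w = n → coord (weightB hn cs) h w ∈ D n}
  have hstable : ∀ i ≠ tIndex hn, ∀ h ∈ S, T (weightB hn cs) (cs.simple i) * h ∈ S :=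
    fun i hi h hh => ⟨T_simple_mul_mem_symAnnihilator i hh.1, fun w hw =>
      (coord_T_simple_mul_mem_iff (hxi n i hi) (hh.2 w hw)).mpr
        (hh.2 _ ((lengthT_simple_mul hn cs hi w).trans hw))⟩
  have hmem : h ∈ S := ⟨hh, htop⟩
  clear hh htop
  induction hk : n - lengthT hn cs w generalizing w h with
  | zero =>
    have hw : lengthT hn cs w = n := le_antisymm (lengthT_le w) (Nat.sub_eq_zero_iff_le.mp hk)
    rw [hw]
    exact hmem.2 w hw
  | succ k ih =>
    obtain ⟨x, hx, hlt⟩ := exists_length_lt_t_mul (hn := hn) (cs := cs) (w := w) (by omega)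
    have hxw := lengthT_mul_of_mem_symSubgroup hn cs hx w
    have hup := lengthT_simple_mul_of_lt hn cs hlt
    rw [if_pos rfl, hxw] at hup
    refine coord_mem_of_coord_mul_mem hstable (hxi _) hx (fun h hh => ?_) hmem
    rw [coord_eq_groundBar_V_mul hh.1 hlt]
    exact hV _ _ (hup ▸ ih _ hh (by omega))

theorem eq_zero_of_mem_symAnnihilator (hh : h ∈ symAnnihilator hn cs)
    (htop : ∀ w, lengthT hn cs w = n → coord (weightB hn cs) h w = 0) : h = 0 :=
  (basis (weightB hn cs)).ext_elem fun w => by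
    rw [map_zero]
    exact coord_mem_of_mem_symAnnihilator (D := fun _ => ⊥)
      (fun _ _ _ a ha => by rw [AddSubgroup.mem_bot.mp ha, mul_zero]; exact zero_mem _)
      (fun _ a ha => by rw [AddSubgroup.mem_bot.mp ha, mul_zero]; exact zero_mem _) hh htop w

theorem exists_mem_symAnnihilator_sub_T_mem {w : W} (hw : lengthT hn cs w = n) :
    ∃ e ∈ symAnnihilator hn cs, e - T (weightB hn cs) w ∈ tFiltration hn cs n := by
  set d := descProd (jucysMurphy (node hn cs)) n
  have hx := mul_inv_mem_symSubgroup hw (lengthT_descProd_jucysMurphy hn cs le_rfl)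
  rw [← inv_mul_cancel_right w d]
  generalize w * d⁻¹ = x at hx
  induction hx using parabolicSubgroup_induction_left with
  | one =>
    rw [one_mul]
    exact ⟨_, murphyProd_mem_symAnnihilator, murphyProd_sub_T_mem_tFiltration _ le_rfl⟩
  | simple_mul i hi x _ ih =>
    obtain ⟨e, he, hed⟩ := ih
    have hmul := T_simple_mul_T (weightB hn cs) i (x * d)
    set c : Ground (ℤ ×ₗ ℤ) :=
      if cs.length (cs.simple i * (x * d)) < cs.length (x * d) then xi (weightB hn cs) i else 0
    refine ⟨T (weightB hn cs) (cs.simple i) * e - c • e,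
      sub_mem (T_simple_mul_mem_symAnnihilator i he) (Submodule.smul_mem _ _ he), ?_⟩
    have hsplit : T (weightB hn cs) (cs.simple i) * e - c • e -
        T (weightB hn cs) (cs.simple i * x * d) =
        T (weightB hn cs) (cs.simple i) * (e - T (weightB hn cs) (x * d)) -
          c • (e - T (weightB hn cs) (x * d)) := by
      rw [mul_sub, hmul, smul_sub, mul_assoc]
      abel
    rw [hsplit]
    exact sub_mem (T_simple_mul_mem_tFiltration_of_ne hi hed) (Submodule.smul_mem _ _ hed)

end SymAnnihilator

section CanonicalBasis

variable {n : ℕ} {hn : 1 ≤ n} {W : Type*} [Group W] {cs : CoxeterSystem (CoxeterMatrix.B n) W}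

/-- The elements of `A = ℤ[V^{±1}, v^{±1}]` of degree at most `k` in `V`. -/
def degreeVLE (k : ℤ) : AddSubgroup (Ground (ℤ ×ₗ ℤ)) :=
  exponentsIn {γ | (ofLex γ).1 ≤ k}

theorem isNegative_of_mem_degreeVLE {k : ℤ} (hk : k < 0) {a : Ground (ℤ ×ₗ ℤ)}
    (ha : a ∈ degreeVLE k) : IsNegative a := fun γ hγ =>
  Prod.Lex.lt_iff.mpr (Or.inl ((ha γ hγ).trans_lt hk))

theorem IsNegative.mem_degreeVLE {a : Ground (ℤ ×ₗ ℤ)} (ha : IsNegative a) : a ∈ degreeVLE 0 :=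
  fun γ hγ => Prod.Lex.monotone_fst _ _ (ha γ hγ).le

theorem one_mem_degreeVLE : (1 : Ground (ℤ ×ₗ ℤ)) ∈ degreeVLE 0 :=
  vpow_mem_exponentsIn (γ := 0) (le_refl (0 : ℤ))

theorem groundBar_V_mul_mem_degreeVLE {k : ℤ} {a : Ground (ℤ ×ₗ ℤ)} (ha : a ∈ degreeVLE (k + 1)) :
    groundBar V * a ∈ degreeVLE k := by
  rw [V, groundBar_vpow]
  refine vpow_mul_mem_exponentsIn ha fun γ hγ => ?_
  change -1 + (ofLex γ).1 ≤ k
  change (ofLex γ).1 ≤ k + 1 at hγ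
  omega

theorem xi_mul_mem_degreeVLE {i : Fin n} (hi : i ≠ tIndex hn) {k : ℤ} {a : Ground (ℤ ×ₗ ℤ)}
    (ha : a ∈ degreeVLE k) : xi (weightB hn cs) i * a ∈ degreeVLE k := by
  have hweight : (ofLex ((weightB hn cs).toFun (cs.simple i))).1 = 0 := by
    simp [weightB, lengthT_simple, hi]
  rw [xi, sub_mul]
  refine sub_mem (vpow_mul_mem_exponentsIn ha fun γ hγ => ?_)
    (vpow_mul_mem_exponentsIn ha fun γ hγ => ?_)
  · change (ofLex ((weightB hn cs).toFun (cs.simple i))).1 + (ofLex γ).1 ≤ k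
    rwa [hweight, zero_add]
  · change -(ofLex ((weightB hn cs).toFun (cs.simple i))).1 + (ofLex γ).1 ≤ k
    rwa [hweight, neg_zero, zero_add]

theorem isNegative_coord_of_mem_symAnnihilator {h : HeckeB hn cs} (hh : h ∈ symAnnihilator hn cs)
    (htop : ∀ w, lengthT hn cs w = n → coord (weightB hn cs) h w ∈ degreeVLE 0) {w : W}
    (hw : lengthT hn cs w ≠ n) : IsNegative (coord (weightB hn cs) h w) := by
  have hlt := (lengthT_le w).lt_of_ne hw
  refine isNegative_of_mem_degreeVLE (k := lengthT hn cs w - n) (by omega) ?_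
  refine coord_mem_of_mem_symAnnihilator (D := fun l => degreeVLE (l - n))
    (fun _ _ hi _ ha => xi_mul_mem_degreeVLE hi ha)
    (fun l a ha => groundBar_V_mul_mem_degreeVLE ?_) hh (by rwa [sub_self]) w
  rwa [Nat.cast_succ, add_sub_right_comm] at ha

variable (hn cs)

/-- The coefficients of an annihilated element on the `T_w` with `ℓ_t(w) = n`. -/
noncomputable def topCoord : symAnnihilator hn cs →ₗ[Ground (ℤ ×ₗ ℤ)]
    {w : W // lengthT hn cs w = n} →₀ Ground (ℤ ×ₗ ℤ) :=
  Finsupp.lsubtypeDomain {w | lengthT hn cs w = n} ∘ₗ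
    (basis (weightB hn cs)).repr.toLinearMap ∘ₗ (symAnnihilator hn cs).subtype

variable {hn cs}

theorem topCoord_eq_single_iff {h : symAnnihilator hn cs} {w : {w : W // lengthT hn cs w = n}} :
    topCoord hn cs h = .single w 1 ↔
      (h : HeckeB hn cs) - T (weightB hn cs) w ∈ tFiltration hn cs n := by
  classical
  have hcoord (y : {w : W // lengthT hn cs w = n}) :
      coord (weightB hn cs) (h - T (weightB hn cs) w) y = 0 ↔
        topCoord hn cs h y = Finsupp.single w 1 y := by
    rw [coord_sub, coord_T, sub_eq_zero, Finsupp.single_apply, if_congr Subtype.ext_iff rfl rfl]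
    rfl
  rw [DFunLike.ext_iff]
  exact ⟨fun heq y hy => (hcoord ⟨y, le_antisymm (lengthT_le y) hy⟩).mpr (heq _),
    fun hmem y => (hcoord y).mp (hmem y y.2.ge)⟩

theorem topCoord_bijective : Function.Bijective (topCoord hn cs) := by
  constructor
  · refine (injective_iff_map_eq_zero _).mpr fun h hh => Subtype.ext ?_
    exact eq_zero_of_mem_symAnnihilator h.2 fun w hw => DFunLike.congr_fun hh ⟨w, hw⟩
  · rw [← LinearMap.range_eq_top, ← top_le_iff, ← Finsupp.basisSingleOne.span_eq, Submodule.span_le]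
    rintro _ ⟨w, rfl⟩
    obtain ⟨e, he, hew⟩ := exists_mem_symAnnihilator_sub_T_mem w.2
    exact ⟨⟨e, he⟩, topCoord_eq_single_iff.mpr hew⟩

variable (hn cs)

/-- The basis of the annihilator dual to the coordinates `topCoord`. -/
noncomputable def topBasis :
    Module.Basis {w : W // lengthT hn cs w = n} (Ground (ℤ ×ₗ ℤ)) (symAnnihilator hn cs) :=
  .ofRepr (.ofBijective (topCoord hn cs) topCoord_bijective)

/-- The bar involution of the annihilator. -/
noncomputable def symBar :
    symAnnihilator hn cs →ₛₗ[groundBar (Γ := ℤ ×ₗ ℤ)] symAnnihilator hn cs :=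
  ((barMap (weightB hn cs)).domRestrict _).codRestrict _ fun h => barMap_mem_symAnnihilator h.2

variable {hn cs}

theorem topBasis_repr (h : symAnnihilator hn cs) (w : {w : W // lengthT hn cs w = n}) :
    (topBasis hn cs).repr h w = coord (weightB hn cs) h w := rfl

theorem topBasis_sub_T_mem (w : {w : W // lengthT hn cs w = n}) :
    (topBasis hn cs w : HeckeB hn cs) - T (weightB hn cs) w ∈ tFiltration hn cs n :=
  topCoord_eq_single_iff.mp ((topBasis hn cs).repr_self w)

theorem isUnitriangularInvolution_symBar : IsUnitriangularInvolution (topBasis hn cs)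
    (symBar hn cs) fun w => cs.length (w : W) where
  involutive h := Subtype.ext (barMap_involutive _ _)
  repr_sub_self w y hwy := by
    have hmem := sub_mem (barMap_mem_tFiltration (topBasis_sub_T_mem w)) (topBasis_sub_T_mem w)
    have htop := hmem y y.2.ge
    have hT := coord_barMap_T_sub (weightB hn cs) hwy
    rw [map_sub, sub_sub_sub_comm, coord_sub, hT, sub_zero] at htop
    exact htop

theorem coord_topBasis_sub_T (c : symAnnihilator hn cs) (w y : {w : W // lengthT hn cs w = n}) :
    coord (weightB hn cs) (c - T (weightB hn cs) w) y =
      (topBasis hn cs).repr (c - topBasis hn cs w) y := by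
  have htop := topBasis_sub_T_mem w y y.2.ge
  rw [coord_sub, sub_eq_zero] at htop
  rw [topBasis_repr, Submodule.coe_sub, coord_sub, coord_sub, htop]

theorem isKazhdanLusztig_of_isCanonical {w : {w : W // lengthT hn cs w = n}}
    {c : symAnnihilator hn cs} (hc : IsCanonical (topBasis hn cs) (symBar hn cs) w c) :
    IsKazhdanLusztig (weightB hn cs) (w : W) c := by
  have hneg {y : W} (hy : lengthT hn cs y = n) :
      IsNegative (coord (weightB hn cs) (c - T (weightB hn cs) w) y) := by
    rw [coord_topBasis_sub_T c w ⟨y, hy⟩]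
    exact hc.2 _
  refine ⟨congrArg Subtype.val hc.1, fun y => ?_⟩
  by_cases hy : lengthT hn cs y = n
  · exact hneg hy
  have hne : (w : W) ≠ y := by rintro rfl; exact hy w.2
  rw [coord_sub, coord_T, if_neg hne, sub_zero]
  refine isNegative_coord_of_mem_symAnnihilator c.2 (fun z hz => ?_) hy
  rw [← sub_add_cancel (c : HeckeB hn cs) (T (weightB hn cs) w), coord_add, coord_T]
  refine add_mem (hneg hz).mem_degreeVLE ?_
  split_ifs
  · exact one_mem_degreeVLE
  · exact zero_mem _

theorem symAnnihilator_eq_spanC : symAnnihilator hn cs = spanC hn cs n := by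
  have hψ := isUnitriangularInvolution_symBar (hn := hn) (cs := cs)
  rw [← Submodule.range_subtype (symAnnihilator hn cs), LinearMap.range_eq_map,
    ← hψ.span_isCanonical, Submodule.map_span, spanC]
  congr 1
  ext c
  constructor
  · rintro ⟨c, ⟨w, hc⟩, rfl⟩
    exact ⟨w, w.2, isKazhdanLusztig_of_isCanonical hc⟩
  · rintro ⟨w, hw, hc⟩
    obtain ⟨c', hc', -⟩ := hψ.exists_isCanonical ⟨w, hw⟩
    exact ⟨c', ⟨_, hc'⟩, (isKazhdanLusztig_of_isCanonical hc').unique _ hc⟩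

end CanonicalBasis

end CoxeterHecke

theorem proposition2p2 {n : ℕ} (hn : 1 ≤ n) {W : Type*} [Group W]
    (cs : CoxeterSystem (CoxeterMatrix.B n) W) (h : CoxeterHecke.HeckeB hn cs) :
    List.TFAE [
      h ∈ CoxeterHecke.spanC hn cs n,
      ∀ x : CoxeterHecke.HeckeB hn cs,
        (CoxeterHecke.Tt hn cs - algebraMap _ _ CoxeterHecke.V) * x * h = 0,
      ∀ x ∈ CoxeterHecke.heckeSym hn cs,
        (CoxeterHecke.Tt hn cs - algebraMap _ _ CoxeterHecke.V) * x * h = 0] := by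
  rw [← CoxeterHecke.symAnnihilator_eq_spanC]
  tfae_have 1 → 2 := fun hh x => by
    have hone := CoxeterHecke.mul_mem_symAnnihilator x hh 1 (one_mem _)
    rwa [mul_one, ← mul_assoc] at hone
  tfae_have 2 → 3 := fun hh x _ => hh x
  tfae_have 3 → 1 := id
  tfae_finish
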